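/- **Setting.** All groups are finite; scalar products $\langle\cdot,\cdot\rangle$ are linear in the first variable; for a finite set $X$, $L(X)$ is the space of complex functions on $X$, and a group acting on $X$ acts on $L(X)$ by $[gf](x)=f(g^{-1}x)$. Let $H$ be a finite group acting by automorphisms on a finite abelian group $A$, with $H\ltimes A$ having product $(h,a)(h',a')=(hh',a+ha')$, and let $H$ act transitively on a finite set $Y$. Let $(B_y)_{y\in Y}$ be finite abelian groups with isomorphisms $h\colon B_y\to B_{hy}$ ($h\in H$) satisfying $(hh')b=h(h'b)$ and $1_Hb=b$, and let $\pi_y\colon A\to B_y$ be surjective homomorphisms with $h\pi_y=\pi_{hy}h$. Then $H\ltimes A$ acts on $X=\{(y,b):y\in Y,\ b\in B_y\}$ by $(h,a)(y,b)=(hy,\pi_{hy}(a)+hb)$. Fix $y_0\in Y$ and put $x_0=(y_0,0)$, $B=B_{y_0}$, $\pi=\pi_{y_0}$, $C=\mathrm{Ker}\,\pi$; let $K$ be the stabilizer of $y_0$ in $H$, so that $K\ltimes C$ is the stabilizer of $x_0$. Assume that $(H\ltimes A,K\ltimes C)$ is a Gelfand pair, i.e. that the permutation representation on $L((H\ltimes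 A)/(K\ltimes C))$ is multiplicity-free. **Characters.** $H$ acts on $\bigsqcup_y\widehat{B_y}$ by ${}^h\chi(b)=\chi(h^{-1}b)$, which maps $\widehat{B_y}$ to $\widehat{B_{hy}}$, and on $\widehat A$ by ${}^h\psi(a)=\psi(h^{-1}a)$. Let $K_z$ be the stabilizer in $K$ of $z\in Y$ and $K_\chi$ the stabilizer in $K$ of $\chi\in\widehat{B_z}$ (inside $K_z$). For $\chi\in\widehat{B_y}$ let $\chi^\sharp\in L(X)$ be $\chi^\sharp(y',b)=\chi(b)$ if $y'=y$ and $0$ otherwise. Let $\Gamma$ be a complete set of representatives $(z,\chi)$ of the $K$-orbits on the set of all $\chi\in\bigsqcup_y\widehat{B_y}$ (with $\chi\in\widehat{B_y}$ written as a pair $(y,\chi)$) that are trivial on $\pi_y(C)$, and for $(z,\chi)\in\Gamma$ put $$\Lambda_{z,\chi}=\frac1{|K_z|\,|C|}\sum_{(k,c)\in K\ltimes C}(k,c)\chi^\sharp .$$ For $\theta\in\widehat B$ let $\psi=\theta\circ\pi\in\widehat A$, $H_\theta=\{h\in H:{}^h\psi=\psi\}$, $K_\theta=H_\theta\cap K$.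 Let $\widehat{B_y}_{,\theta}$ be the set of $\chi\in\widehat{B_y}$ for which there is $h(\chi)\in H$ with $h(\chi)y_0=y$ and ${}^{h(\chi)}\theta=\chi$. Let $\Gamma_\theta$ be the set of $(z,\chi)\in\Gamma$ for which there are $k(\chi)\in K$ and $h_0(\chi)\in H_\theta$ with $z=k(\chi)h_0(\chi)y_0$ and $\chi={}^{k(\chi)h_0(\chi)}\theta$. **Representations.** Let $\theta\in\widehat B$, and let $\sigma=\sigma_{\theta,j}$ be an irreducible unitary representation of $H_\theta$, on $U=U_{\theta,j}$, that occurs in $L(H_\theta/K_\theta)$. For a finite group $G$, a subgroup $S\le G$ and a unitary representation $\tau$ of $S$ on $U$, $\mathrm{Ind}_S^GU$ is the space of all $f\colon G\to U$ with $f(gs)=\tau(s^{-1})f(g)$, with $[gf](x)=f(g^{-1}x)$ and $\langle f_1,f_2\rangle=\frac1{|S|}\sum_{g\in G}\langle f_1(g),f_2(g)\rangle$. Let $W=W_{\theta,j}$ be the representation of $H\ltimes A$ induced from the representation $(h,a)\mapsto\overline{\psi(a)}\,\sigma(h)$ of $H_\theta\ltimes A$ on $U$. For $f\in\mathrm{Ind}_{H_\theta}^HU$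 let $F_f\in W$ be $F_f(h,a)={}^h\psi(a)f(h)$. **Theorem.** $U$ contains a $K_\theta$-invariant vector of norm $1$. Let $u$ be any such vector, and set, for $h\in H_\theta$ and $v\in U$, $$\varphi_{\theta,j}(h)=\langle u,\sigma(h)u\rangle,\qquad [T_{\theta,j}v](h)=\sqrt{\frac{|K_\theta|\dim\sigma}{|H_\theta|}}\,\langle v,\sigma(h)u\rangle .$$ 1. The function $$F_{\theta,j}(h,a)=\frac{{}^h\psi(a)}{\sqrt{|K|\,|K_\theta|}}\sum_{h_0\in(h^{-1}K)\cap H_\theta}\sigma(h_0^{-1})^*u$$ is a $(K\ltimes C)$-invariant vector of norm $1$ in $W$. 2. There is a function $\Phi_{\theta,j}\in L(X)$ (unique, as $H\ltimes A$ is transitive on $X$), the spherical function associated with $F_{\theta,j}$, such that $\Phi_{\theta,j}(gx_0)=\langle F_{\theta,j},gF_{\theta,j}\rangle_W$ for all $g\in H\ltimes A$. For every choice of the $h_0(\chi)$, $$\Phi_{\theta,j}=\frac{|K_\theta|}{|K|}\sum_{(z,\chi)\in\Gamma_\theta}\frac{|K_z|}{|K_\chi|}\,\varphi_{\theta,j}(h_0(\chi))\,\Lambda_{z,\chi}.$$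 3. There is an intertwining operator $S_{\theta,j}\colon W\to L(X)$, the one associated with $F_{\theta,j}$, such that for all $w\in W$ and $g\in H\ltimes A$ $$[S_{\theta,j}w](gx_0)=\sqrt{\frac{|K\ltimes C|\,\dim W}{|H\ltimes A|}}\,\langle w,gF_{\theta,j}\rangle_W .$$ Let $\mathcal T$ and $\mathcal S$ be complete sets of representatives for the left cosets of $H_\theta$ in $H$ and of $K_\theta$ in $H_\theta$. For $\chi\in\widehat{B_y}_{,\theta}$ choose $h(\chi)$ as above and write $h(\chi)=t(\chi)s(\chi)k(\chi)$ with $t(\chi)\in\mathcal T$, $s(\chi)\in\mathcal S$ and $k(\chi)\in K_\theta$. Then, for all $f\in\mathrm{Ind}_{H_\theta}^HU$, $$S_{\theta,j}F_f=\frac1{\sqrt{|B|}}\sum_{y\in Y}\sum_{\chi\in\widehat{B_y}_{,\theta}}\bigl[T_{\theta,j}f(t(\chi))\bigr](s(\chi))\,\chi^\sharp .$$ -/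

import Mathlib

open scoped Classical

noncomputable section

namespace SphSemi

/-! ### Generalities on representations of a finite group -/

section General

variable {G : Type*} [Group G]

/-- The scalar product of a complex inner product space, linear in the FIRST variable and
conjugate-linear in the second one. -/
def sp {V : Type*} [NormedAddCommGroup V] [InnerProductSpace ℂ V] (v w : V) : ℂ := inner ℂ w v

/-- The permutation representation on `L(X)`, `[g f](x) = f (g⁻¹ x)`. -/
def permRep (G : Type*) [Group G] (X : Type*) [MulAction G X] : Representation ℂ G (X → ℂ) where
  toFun g :=
    { toFun := fun f x => f (g⁻¹ • x)
      map_add' := fun _ _ => rfl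
      map_smul' := fun _ _ => rfl }
  map_one' := by ext; simp
  map_mul' g h := by
    refine LinearMap.ext fun f => funext fun x => ?_
    simp [mul_smul]

/-- A representation is multiplicity-free when it decomposes as a direct sum of irreducible
subrepresentations that are pairwise inequivalent. -/
def IsMultiplicityFree {V : Type*} [AddCommGroup V] [Module ℂ V]
    (ρ : Representation ℂ G V) : Prop :=
  ∃ (n : ℕ) (V' : Fin n → Subrepresentation ρ),
    DirectSum.IsInternal (fun i => (V' i).toSubmodule) ∧
    (∀ i, (V' i).toRepresentation.IsIrreducible) ∧
    ∀ i j, i ≠ j → IsEmpty ((V' i).toRepresentation.Equiv (V' j).toRepresentation)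

/-- `(G, K)` is a Gelfand pair: the permutation representation of `G` on `L(G/K)` is
multiplicity-free. -/
def IsGelfandPair (K : Subgroup G) : Prop := IsMultiplicityFree (permRep G (G ⧸ K))

/-- The representation `σ` occurs in `L(G/K)`. -/
def OccursIn (K : Subgroup G) {U : Type*} [AddCommGroup U] [Module ℂ U]
    (σ : Representation ℂ G U) : Prop :=
  ∃ T : Representation.IntertwiningMap σ (permRep G (G ⧸ K)), T ≠ 0

/-- The representation is unitary. -/
def IsUnitaryRep {U : Type*} [NormedAddCommGroup U] [InnerProductSpace ℂ U]
    (σ : Representation ℂ G U) : Prop :=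
  ∀ g u v, sp (σ g u) (σ g v) = sp u v

/-- The function on `G` associated with a function on a `G`-space with base point:
`g ↦ f (g x₀)`. -/
def toGroup {X : Type*} [MulAction G X] (x₀ : X) (f : X → ℂ) : G → ℂ := fun g => f (g • x₀)

/-- The space of the induced representation `Ind_K^G σ`: all `f : G → U` such that
`f (g k) = σ(k⁻¹) f(g)`. -/
def indSpace (K : Subgroup G) {U : Type*} [AddCommGroup U] [Module ℂ U]
    (σ : Representation ℂ K U) : Submodule ℂ (G → U) where
  carrier := {f | ∀ (g : G) (k : K), f (g * k) = σ k⁻¹ (f g)}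
  add_mem' hf hf' g k := by simp [hf g k, hf' g k]
  zero_mem' g k := by simp
  smul_mem' c f hf g k := by simp [hf g k]

/-- The induced representation, `[g f](x) = f (g⁻¹ x)`. -/
def indRep (K : Subgroup G) {U : Type*} [AddCommGroup U] [Module ℂ U]
    (σ : Representation ℂ K U) : Representation ℂ G (indSpace K σ) where
  toFun g :=
    { toFun := fun f => ⟨fun x => f.1 (g⁻¹ * x), fun x k => by
        have := f.2 (g⁻¹ * x) k
        rwa [mul_assoc] at this⟩
      map_add' := fun _ _ => rfl
      map_smul' := fun _ _ => rfl }
  map_one' := by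
    refine LinearMap.ext fun f => Subtype.ext (funext fun x => ?_)
    simp
  map_mul' g h := by
    refine LinearMap.ext fun f => Subtype.ext (funext fun x => ?_)
    simp [mul_assoc]

/-- The scalar product of the induced representation,
`⟨f₁, f₂⟩ = |K|⁻¹ ∑_{g ∈ G} ⟨f₁(g), f₂(g)⟩`. -/
def indInner [Fintype G] (K : Subgroup G) {U : Type*} [NormedAddCommGroup U]
    [InnerProductSpace ℂ U] (σ : Representation ℂ K U) (f₁ f₂ : indSpace K σ) : ℂ :=
  (Nat.card K : ℂ)⁻¹ * ∑ g : G, sp (f₁.1 g) (f₂.1 g)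

/-- The spherical function, as a function on the group, associated with the invariant vector `w`
of the representation `ρ` with scalar product `ip`: `g ↦ ⟨w, ρ(g) w⟩`. -/
def sphFun {V : Type*} [AddCommGroup V] [Module ℂ V] (ip : V → V → ℂ)
    (ρ : Representation ℂ G V) (w : V) : G → ℂ :=
  fun g => ip w (ρ g w)

/-- The intertwining operator `V → L(G/K)` associated with the `K`-invariant vector `w` of the
representation `ρ` on `V` with scalar product `ip`; its values are written as functions on `G`:
`[T v](g) = √(|K| dim V / |G|) ⟨v, ρ(g) w⟩`. -/
def sphOp (K : Subgroup G) {V : Type*} [AddCommGroup V] [Module ℂ V] (ip : V → V → ℂ)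
    (ρ : Representation ℂ G V) (w v : V) : G → ℂ :=
  fun g => (Real.sqrt ((Nat.card K : ℝ) * Module.finrank ℂ V / Nat.card G) : ℂ) * ip v (ρ g w)

end General

/-! ### Semidirect products and the little group method -/

section Semidirect

variable (H A : Type*) [Group H] [AddCommGroup A] [DistribMulAction H A]

/-- The action of `H` on `A`, with `A` written multiplicatively. -/
def actHom : H →* MulAut (Multiplicative A) where
  toFun h :=
    { toFun := fun a => Multiplicative.ofAdd (h • a.toAdd)
      invFun := fun a => Multiplicative.ofAdd (h⁻¹ • a.toAdd)
      left_inv := fun a => by simp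
      right_inv := fun a => by simp
      map_mul' := fun a b => by simp }
  map_one' := by ext a; simp
  map_mul' h h' := by ext a; simp [mul_smul]

/-- The semidirect product `H ⋉ A`; the pair `(h, a)` is the element `g` with `g.right = h` and
`g.left = a`, and `(h, a)(h', a') = (h h', a + h a')`. -/
abbrev Semi := Multiplicative A ⋊[actHom H A] H

variable {H A}

instance [Fintype H] [Fintype A] : Fintype (Semi H A) :=
  Fintype.ofEquiv (Multiplicative A × H) SemidirectProduct.equivProd.symm

/-- The subgroup `K ⋉ C`, for a subgroup `K` of `H` and a `K`-invariant subgroup `C` of `A`. -/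
def subSemi (K : Subgroup H) (C : AddSubgroup A) (hC : ∀ k ∈ K, ∀ c ∈ C, k • c ∈ C) :
    Subgroup (Semi H A) where
  carrier := {g | g.right ∈ K ∧ g.left.toAdd ∈ C}
  mul_mem' {g g'} hg hg' := by
    refine ⟨K.mul_mem hg.1 hg'.1, ?_⟩
    simpa [actHom] using C.add_mem hg.2 (hC _ hg.1 _ hg'.2)
  one_mem' := ⟨K.one_mem, C.zero_mem⟩
  inv_mem' {g} hg := by
    refine ⟨K.inv_mem hg.1, ?_⟩
    simpa [actHom] using hC _ (K.inv_mem hg.1) _ hg.2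

/-- The stabilizer `H_ψ` in `H` of the character `ψ` of `A`, where `ʰψ(a) = ψ(h⁻¹ a)`. -/
def charStab (ψ : AddChar A ℂ) : Subgroup H where
  carrier := {h | ∀ a, ψ (h⁻¹ • a) = ψ a}
  mul_mem' {h h'} hh hh' a := by
    rw [mul_inv_rev, mul_smul, show ψ (h'⁻¹ • h⁻¹ • a) = ψ (h⁻¹ • a) from hh' _]
    exact hh a
  one_mem' a := by simp
  inv_mem' {h} hh a := by
    have := hh (h • a)
    simpa using this.symm

/-- The inertia group `H_ψ ⋉ A`. -/
def inertia (ψ : AddChar A ℂ) : Subgroup (Semi H A) :=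
  subSemi (charStab ψ) ⊤ fun _ _ _ _ => trivial

lemma charStab_smul {ψ : AddChar A ℂ} {h : H} (hh : h ∈ charStab ψ) (a : A) :
    ψ (h • a) = ψ a := by
  have := (charStab ψ).inv_mem hh a
  simpa using this

/-- The representation of the inertia group `H_ψ ⋉ A` given by the product of the extension of the
conjugate character of `ψ` with the inflation of the representation `σ` of `H_ψ`:
`(h, a) ↦ conj (ψ a) • σ h`. -/
def inertiaRep (ψ : AddChar A ℂ) {U : Type*} [AddCommGroup U] [Module ℂ U]
    (σ : Representation ℂ (charStab (H := H) ψ) U) :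
    Representation ℂ (inertia (H := H) ψ) U where
  toFun g := (starRingEnd ℂ (ψ g.1.left.toAdd)) • σ ⟨g.1.right, g.2.1⟩
  map_one' := by
    have h1 : σ ⟨(1 : inertia (H := H) ψ).1.right, (1 : inertia (H := H) ψ).2.1⟩ = 1 :=
      map_one σ
    rw [h1]
    simp
  map_mul' g g' := by
    have h1 : (⟨(g * g').1.right, (g * g').2.1⟩ : charStab (H := H) ψ) =
      ⟨g.1.right, g.2.1⟩ * ⟨g'.1.right, g'.2.1⟩ := rfl
    have h2 : ψ (g * g').1.left.toAdd = ψ g.1.left.toAdd * ψ g'.1.left.toAdd := by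
      have : (g * g').1.left.toAdd = g.1.left.toAdd + g.1.right • g'.1.left.toAdd := by
        simp [actHom]
      rw [this, AddChar.map_add_eq_mul, charStab_smul g.2.1]
    rw [h1, h2, map_mul, map_mul]
    ext u
    simp [smul_smul, mul_comm]

/-- The space `W` of the representation of `H ⋉ A` induced from `inertiaRep ψ σ`. -/
abbrev WSpace (ψ : AddChar A ℂ) {U : Type*} [AddCommGroup U] [Module ℂ U]
    (σ : Representation ℂ (charStab (H := H) ψ) U) : Submodule ℂ (Semi H A → U) :=
  indSpace (inertia ψ) (inertiaRep ψ σ)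

/-- The induced representation of `H ⋉ A` on `W`. -/
abbrev WRep (ψ : AddChar A ℂ) {U : Type*} [AddCommGroup U] [Module ℂ U]
    (σ : Representation ℂ (charStab (H := H) ψ) U) :
    Representation ℂ (Semi H A) (WSpace ψ σ) :=
  indRep (inertia ψ) (inertiaRep ψ σ)

/-- The scalar product of `W`. -/
abbrev WInner [Fintype H] [Fintype A] (ψ : AddChar A ℂ) {U : Type*}
    [NormedAddCommGroup U] [InnerProductSpace ℂ U]
    (σ : Representation ℂ (charStab (H := H) ψ) U) : WSpace ψ σ → WSpace ψ σ → ℂ :=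
  indInner (inertia ψ) (inertiaRep ψ σ)

/-- For `f` in the space of `Ind_{H_ψ}^H σ`, the element `F_f` of `W`,
`F_f(h, a) = ʰψ(a) f(h)` (the character of `A` that is extended and induced is the conjugate
of `ψ`). -/
def liftW [Finite A] (ψ : AddChar A ℂ) {U : Type*} [AddCommGroup U] [Module ℂ U]
    (σ : Representation ℂ (charStab (H := H) ψ) U) (f : indSpace (charStab ψ) σ) :
    WSpace (H := H) ψ σ :=
  ⟨fun g => ψ (g.right⁻¹ • g.left.toAdd) • f.1 g.right, by
    rintro g ⟨s, hs⟩
    have hf := f.2 g.right ⟨s.right, hs.1⟩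
    have hl : (g * s).left.toAdd = g.left.toAdd + g.right • s.left.toAdd := by
      simp [actHom]
    have hs' : s.right⁻¹ ∈ charStab (H := H) ψ := (charStab ψ).inv_mem hs.1
    have key : ψ ((g * s).right⁻¹ • (g * s).left.toAdd) =
        ψ (g.right⁻¹ • g.left.toAdd) * ψ s.left.toAdd := by
      rw [hl, SemidirectProduct.mul_right, mul_inv_rev, mul_smul, smul_add, inv_smul_smul,
        charStab_smul hs', AddChar.map_add_eq_mul]
    have hc : starRingEnd ℂ (ψ (s⁻¹).left.toAdd) = ψ s.left.toAdd := by
      have : (s⁻¹).left.toAdd = - (s.right⁻¹ • s.left.toAdd) := by simp [actHom]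
      rw [this, AddChar.map_neg_eq_conj, charStab_smul hs']
      simp
    change ψ ((g * s).right⁻¹ • (g * s).left.toAdd) • f.1 (g.right * s.right) =
      starRingEnd ℂ (ψ (s⁻¹).left.toAdd) •
        σ (⟨s.right, hs.1⟩ : charStab (H := H) ψ)⁻¹ (ψ (g.right⁻¹ • g.left.toAdd) • f.1 g.right)
    rw [key, hc, LinearMap.map_smul, smul_smul, mul_comm]
    exact congrArg _ hf⟩

end Semidirect

/-! ### The homogeneous space `X = (H ⋉ A)/(K ⋉ C)` -/

/-- The data on which the homogeneous space is built: a family `(B_y)` of abelian groups indexed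
by the `H`-space `Y`, isomorphisms `h : B_y → B_{hy}` with `(hh')b = h(h'b)` and `1b = b`, and
surjective homomorphisms `π_y : A → B_y` such that `h π_y = π_{hy} h`. -/
structure FibreSystem (H A Y : Type*) [Group H] [AddCommGroup A] [DistribMulAction H A]
    [MulAction H Y] (B : Y → Type*) [∀ y, AddCommGroup (B y)] where
  act : ∀ (h : H) (y : Y), B y ≃+ B (h • y)
  act_one : ∀ (y : Y) (b : B y), (⟨(1 : H) • y, act 1 y b⟩ : Σ y, B y) = ⟨y, b⟩
  act_mul : ∀ (h h' : H) (y : Y) (b : B y),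
    (⟨(h * h') • y, act (h * h') y b⟩ : Σ y, B y) =
      ⟨h • h' • y, act h (h' • y) (act h' y b)⟩
  proj : ∀ y : Y, A →+ B y
  proj_surjective : ∀ y, Function.Surjective (proj y)
  act_proj : ∀ (h : H) (y : Y) (a : A), act h y (proj y a) = proj (h • y) (h • a)

namespace FibreSystem

variable {H A Y : Type*} [Group H] [AddCommGroup A] [DistribMulAction H A]
  [MulAction H Y] {B : Y → Type*} [∀ y, AddCommGroup (B y)] (S : FibreSystem H A Y B)

/-- The space `X = {(y, b) : y ∈ Y, b ∈ B_y}`. -/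
def Total (_S : FibreSystem H A Y B) := Σ y, B y

/-- The disjoint union of the dual groups of the `B_y`, `y ∈ Y`. As the `B_y` are finite, their
characters, that is the homomorphisms into the circle group, are the homomorphisms into the
multiplicative monoid of `ℂ`. -/
def Dual (_S : FibreSystem H A Y B) := Σ y, AddChar (B y) ℂ

/-- The point `(y, b)` of `X`. -/
def pt (y : Y) (b : B y) : S.Total := ⟨y, b⟩

/-- The character `χ` of `B_y`, as an element of the disjoint union. -/
def dpt (y : Y) (χ : AddChar (B y) ℂ) : S.Dual := ⟨y, χ⟩

instance [Fintype Y] [∀ y, Fintype (B y)] : Fintype S.Total :=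
  inferInstanceAs (Fintype (Σ y, B y))

instance [Fintype Y] [∀ y, Fintype (B y)] : Fintype S.Dual :=
  inferInstanceAs (Fintype (Σ y, AddChar (B y) ℂ))

lemma exists_eq_pt (x : S.Total) : ∃ (y : Y) (a : A), x = S.pt y (S.proj y a) := by
  obtain ⟨y, b⟩ := x
  obtain ⟨a, rfl⟩ := S.proj_surjective y b
  exact ⟨y, a, rfl⟩

lemma dual_ext {p q : S.Dual} (h1 : p.1 = q.1)
    (h2 : ∀ a, p.2 (S.proj p.1 a) = q.2 (S.proj q.1 a)) : p = q := by
  obtain ⟨y, χ⟩ := p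
  obtain ⟨y', χ'⟩ := q
  dsimp only at h1
  subst h1
  congr 1
  ext b
  obtain ⟨a, rfl⟩ := S.proj_surjective y b
  exact h2 a

/-- The action of `H ⋉ A` on `X`, `(h, a)(y, b) = (h y, π_{hy}(a) + h b)`. -/
instance : SMul (Semi H A) S.Total where
  smul g x := S.pt (g.right • x.1) (S.proj (g.right • x.1) g.left.toAdd + S.act g.right x.1 x.2)

lemma smul_pt (g : Semi H A) (y : Y) (b : B y) :
    g • S.pt y b = S.pt (g.right • y) (S.proj (g.right • y) g.left.toAdd + S.act g.right y b) :=
  rfl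

lemma smul_pt_proj (g : Semi H A) (y : Y) (a : A) :
    g • S.pt y (S.proj y a) =
      S.pt (g.right • y) (S.proj (g.right • y) (g.left.toAdd + g.right • a)) := by
  rw [smul_pt, act_proj, map_add]

instance : MulAction (Semi H A) S.Total where
  one_smul x := by
    obtain ⟨y, a, rfl⟩ := S.exists_eq_pt x
    rw [smul_pt_proj, SemidirectProduct.one_right, SemidirectProduct.one_left, toAdd_one,
      zero_add, one_smul, one_smul]
  mul_smul g g' x := by
    obtain ⟨y, a, rfl⟩ := S.exists_eq_pt x
    rw [smul_pt_proj, smul_pt_proj, smul_pt_proj, SemidirectProduct.mul_right, mul_smul,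
      SemidirectProduct.mul_left]
    simp [actHom, mul_smul, add_assoc]

/-- The action of `H` on the disjoint union of the dual groups: for a character `χ` of `B_y`,
`ʰχ` is the character of `B_{hy}` given by `ʰχ(b) = χ(h⁻¹ b)`. -/
instance : SMul H S.Dual where
  smul h p := S.dpt (h • p.1) (p.2.compAddMonoidHom (S.act h p.1).symm.toAddMonoidHom)

lemma smul_dual_apply (h : H) (p : S.Dual) (a : A) :
    (h • p).2 (S.proj (h • p).1 a) = p.2 (S.proj p.1 (h⁻¹ • a)) := by
  change p.2 ((S.act h p.1).symm (S.proj (h • p.1) a)) = _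
  congr 1
  rw [AddEquiv.symm_apply_eq, act_proj, smul_inv_smul]

instance : MulAction H S.Dual where
  one_smul p := by
    refine S.dual_ext (one_smul H p.1) fun a => ?_
    rw [smul_dual_apply]; simp
  mul_smul h h' p := by
    refine S.dual_ext (mul_smul h h' p.1) fun a => ?_
    rw [smul_dual_apply, smul_dual_apply, smul_dual_apply, mul_inv_rev, mul_smul]

variable (y₀ : Y)

/-- The base point `(y₀, 0)` of `X`. -/
def base : S.Total := S.pt y₀ 0

/-- `C = Ker π_{y₀}`. -/
def C : AddSubgroup A := (S.proj y₀).ker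

lemma smul_mem_C (k : H) (hk : k ∈ MulAction.stabilizer H y₀) (c : A) (hc : c ∈ S.C y₀) :
    k • c ∈ S.C y₀ := by
  have h1 : S.proj (k • y₀) (k • c) = 0 := by
    rw [← act_proj, show S.proj y₀ c = 0 from hc, map_zero]
  rw [MulAction.mem_stabilizer_iff.1 hk] at h1
  exact h1

/-- The subgroup `K ⋉ C` of `H ⋉ A`, where `K` is the stabilizer of `y₀` in `H`. -/
def KC : Subgroup (Semi H A) :=
  subSemi (MulAction.stabilizer H y₀) (S.C y₀) (S.smul_mem_C y₀)

/-- The inflation to `A` of a character of `B_{y₀}`. -/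
def infl (θ : AddChar (B y₀) ℂ) : AddChar A ℂ := θ.compAddMonoidHom (S.proj y₀)

/-- `H_θ`, the stabilizer in `H` of the inflation of `θ`. -/
abbrev Hst (θ : AddChar (B y₀) ℂ) : Subgroup H := charStab (S.infl y₀ θ)

/-- `K_θ = H_θ ∩ K`, as a subgroup of `H_θ`. -/
abbrev Kst (θ : AddChar (B y₀) ℂ) : Subgroup (S.Hst y₀ θ) :=
  (MulAction.stabilizer H y₀).subgroupOf (S.Hst y₀ θ)

/-- `K_z`, the stabilizer in `K` of `z ∈ Y`. -/
def Kpt (z : Y) : Subgroup H := MulAction.stabilizer H y₀ ⊓ MulAction.stabilizer H z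

/-- `K_χ`, the stabilizer in `K` of a character `χ` of some `B_y`. -/
def Kch (p : S.Dual) : Subgroup H := MulAction.stabilizer H y₀ ⊓ MulAction.stabilizer H p

/-- The function `χ^♯` on `X`: for a character `χ` of `B_y`, its value at `(y', b)` is `χ(b)` if
`y' = y`, and `0` otherwise. -/
def sharp (p : S.Dual) : S.Total → ℂ :=
  fun x => if h : x.1 = p.1 then p.2 (h ▸ x.2) else 0

/-- The disjoint union over `y` of the sets of the characters `χ` of `B_y` that are trivial on
`π_y(C)`. -/
def dual0 : Set S.Dual := {p | ∀ c ∈ S.C y₀, p.2 (S.proj p.1 c) = 1}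

/-- `Γ` is a complete set of representatives for the orbits of `K` on the set of the characters
`χ` of the groups `B_y` that are trivial on `π_y(C)`. -/
def IsTransversal (Γ : Set S.Dual) : Prop :=
  Γ ⊆ S.dual0 y₀ ∧
    ∀ q ∈ S.dual0 y₀, ∃! p, p ∈ Γ ∧ ∃ k ∈ MulAction.stabilizer H y₀, k • p = q

/-- The subset `Γ_θ` of `Γ`: the pairs `(z, χ)` for which there are `k ∈ K` and `h₀ ∈ H_θ` with
`z = k h₀ y₀` and `χ` the `k h₀`-translate of `θ`. -/
def GammaTheta (Γ : Set S.Dual) (θ : AddChar (B y₀) ℂ) : Set S.Dual :=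
  {p | p ∈ Γ ∧ ∃ k ∈ MulAction.stabilizer H y₀, ∃ h ∈ S.Hst y₀ θ, p = (k * h) • S.dpt y₀ θ}

/-- The disjoint union over `y` of the sets of the characters of `B_y` that are
`H`-translates of `θ`. -/
def dualTheta (θ : AddChar (B y₀) ℂ) : Set S.Dual :=
  {p | ∃ h : H, h • S.dpt y₀ θ = p}

/-- `Λ_{z,χ} = (|K_z| |C|)⁻¹ ∑_{(k,c) ∈ K ⋉ C} (k,c) χ^♯`. -/
def Lam [Fintype H] [Fintype A] (p : S.Dual) : S.Total → ℂ :=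
  ((Nat.card (Kpt (H := H) y₀ p.1) : ℂ) * Nat.card (S.C y₀))⁻¹ •
    ∑ g : S.KC y₀, permRep (Semi H A) S.Total g.1 (S.sharp p)

/-- The function `F_{θ,j}` on `H ⋉ A` attached to the representation `σ = σ_{θ,j}` of `H_θ` and to
its `K_θ`-invariant vector `u`:
`F(h, a) = ʰθ(a) (|K| |K_θ|)^{-1/2} ∑_{h₀ ∈ h⁻¹K ∩ H_θ} σ(h₀⁻¹)^* u`. -/
def sphVec [Fintype H] (θ : AddChar (B y₀) ℂ) {U : Type*} [NormedAddCommGroup U]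
    [InnerProductSpace ℂ U] [FiniteDimensional ℂ U]
    (σ : Representation ℂ (S.Hst y₀ θ) U) (u : U) : Semi H A → U :=
  fun g =>
    (S.infl y₀ θ (g.right⁻¹ • g.left.toAdd) /
      (Real.sqrt (Nat.card (MulAction.stabilizer H y₀) * Nat.card (S.Kst y₀ θ)) : ℂ)) •
    ∑ h₀ : ↥(S.Hst y₀ θ) with g.right * h₀.1 ∈ MulAction.stabilizer H y₀,
      LinearMap.adjoint (σ h₀⁻¹) u

end FibreSystem

end SphSemi

end

/-!
The representation `W` is isomorphic to `Ind_{H_θ}^H U` through `f ↦ F_f`, on which `A` acts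
through the translates of `ψ`. Let `f_u(h)` be the sum of `σ(h₀) u` over the `h₀ ∈ H_θ` with
`h h₀ ∈ K` (`orbitSum`). This element of the induced space is left `K`-invariant and supported on
`K H_θ`, where the translates of `ψ` are trivial on `C`; so its lift is `K ⋉ C`-invariant, and up to
the factor `√(|K| |K_θ|)⁻¹` it is the vector `F_{θ,j}` (`invVec`).

All the scalar products follow from one computation (`WInner_WRep_invVec`): by the unitarity of `σ`,
for `f ∈ Ind_{H_θ}^H U` and `g = (x, a)`,
`⟨F_f, g F_{θ,j}⟩ = √(|K| |K_θ|)⁻¹ ∑_{h ∈ x K} ψ(h⁻¹ a) ⟨f(h), u⟩`.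

* At `g = 1` and `F_f = F_{θ,j}` it gives the norm of `F_{θ,j}`.
* For `F_f = F_{θ,j}` it becomes the sum over `l ∈ H_θ` of `⟨u, σ(l) u⟩` times the sum of
  `ψ(k⁻¹ a)` over the `k ∈ K` with `k l y₀ = x y₀` (`sphFun_invVec`). Both factors are
  `K_θ`-bi-invariant in `l`. The map that sends `l` to the representative in `Γ` of the `K`-orbit of
  `ˡθ` identifies the double cosets of `K_θ` in `H_θ` with `Γ_θ`, and the double coset of
  `p ∈ Γ_θ` has `|K_θ|² / |K_p|` elements (`sum_biinvariant`). The inner sum at `l` is a multiple of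
  `Λ_p` (`Lam_eq_orbitCharSum`), which gives the expansion of the spherical function.
* For arbitrary `f` the summand depends only on the coset `h K_θ`, that is on the character `ʰθ`
  (`sum_eq_sum_dualTheta`), which gives the expansion of `S_{θ,j} F_f` in the functions `χ^♯`. The
  constants match because `dim W = |H| dim σ / |H_θ|` (`card_mul_finrank_indSpace`) and
  `|A| = |C| |B|`.

Scalar-valued functions on `X` are compared at the points `g x₀`, as `H ⋉ A` is transitive on `X`
with stabilizer `K ⋉ C` of `x₀`.
-/

noncomputable section

namespace SphSemi

/-! ### The scalar product and unitary representations -/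

section Unitary

variable {G U : Type*} [Group G] [NormedAddCommGroup U] [InnerProductSpace ℂ U]

lemma sp_smul_left (c : ℂ) (v w : U) : sp (c • v) w = c * sp v w := inner_smul_right _ _ _

lemma sp_smul_right (c : ℂ) (v w : U) : sp v (c • w) = starRingEnd ℂ c * sp v w :=
  inner_smul_left _ _ _

lemma sp_sum_left {ι : Type*} (s : Finset ι) (f : ι → U) (w : U) :
    sp (∑ i ∈ s, f i) w = ∑ i ∈ s, sp (f i) w := inner_sum _ _ _

lemma sp_sum_right {ι : Type*} (s : Finset ι) (f : ι → U) (w : U) :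
    sp w (∑ i ∈ s, f i) = ∑ i ∈ s, sp w (f i) := sum_inner _ _ _

lemma sp_self_eq_one {u : U} (hu : ‖u‖ = 1) : sp u u = 1 := by
  simp [sp, inner_self_eq_norm_sq_to_K, hu]

lemma IsUnitaryRep.sp_apply_right {σ : Representation ℂ G U} (hσ : IsUnitaryRep σ)
    (g : G) (v w : U) : sp v (σ g w) = sp (σ g⁻¹ v) w := by
  rw [← hσ g (σ g⁻¹ v) w, Representation.self_inv_apply]

lemma IsUnitaryRep.adjoint_inv [FiniteDimensional ℂ U] {σ : Representation ℂ G U}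
    (hσ : IsUnitaryRep σ) (g : G) (u : U) : LinearMap.adjoint (σ g⁻¹) u = σ g u := by
  refine ext_inner_right ℂ fun v => ?_
  rw [LinearMap.adjoint_inner_left]
  exact (hσ.sp_apply_right g v u).symm

/-- The vector is the Riesz dual of the functional `v ↦ (T v)(K)`, where `T : U → L(G/K)` is a
nonzero intertwining operator. -/
lemma OccursIn.exists_invariant [FiniteDimensional ℂ U] {K : Subgroup G}
    {σ : Representation ℂ G U} (hσ : IsUnitaryRep σ) (hocc : OccursIn K σ) :
    ∃ u : U, ‖u‖ = 1 ∧ ∀ k ∈ K, σ k u = u := by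
  obtain ⟨T, hT⟩ := hocc
  have hTapp : ∀ (g : G) (v : U) (x : G ⧸ K), T (σ g v) x = T v (g⁻¹ • x) := fun g v x =>
    congrFun (T.isIntertwining _ _ g v) x
  let ev : U →ₗ[ℂ] ℂ := LinearMap.proj (R := ℂ) (φ := fun _ : G ⧸ K => ℂ)
    ((1 : G) : G ⧸ K) ∘ₗ T.toLinearMap
  have hev : ∀ v, ev v = T v ((1 : G) : G ⧸ K) := fun _ => rfl
  let w : U := (InnerProductSpace.toDual ℂ U).symm (LinearMap.toContinuousLinearMap ev)
  have hw : ∀ v, inner ℂ w v = T v ((1 : G) : G ⧸ K) := fun v => by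
    rw [InnerProductSpace.toDual_symm_apply]; exact hev v
  have hinv : ∀ k ∈ K, σ k w = w := by
    intro k hk
    refine ext_inner_right ℂ fun v => ?_
    have h1 : inner ℂ (σ k w) v = inner ℂ w (σ k⁻¹ v) := hσ.sp_apply_right k v w
    rw [h1, hw, hw, hTapp, inv_inv]
    have h2 : k • ((1 : G) : G ⧸ K) = ((1 : G) : G ⧸ K) := by
      change ((k * 1 : G) : G ⧸ K) = _
      rw [QuotientGroup.eq]
      simpa using hk
    rw [h2]
  have hne : w ≠ 0 := by
    rintro h0
    refine hT (Representation.IntertwiningMap.ext (LinearMap.ext fun v => ?_))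
    funext x
    obtain ⟨g, rfl⟩ := QuotientGroup.mk_surjective x
    have h2 := hw (σ g⁻¹ v)
    rw [h0, inner_zero_left, hTapp, inv_inv] at h2
    have h3 : g • ((1 : G) : G ⧸ K) = (g : G ⧸ K) := by
      change ((g * 1 : G) : G ⧸ K) = _
      rw [mul_one]
    rw [h3] at h2
    simpa using h2.symm
  refine ⟨((‖w‖ : ℂ)⁻¹) • w, ?_, fun k hk => by rw [map_smul, hinv k hk]⟩
  rw [norm_smul, norm_inv, Complex.norm_real, norm_norm, inv_mul_cancel₀ (norm_ne_zero_iff.2 hne)]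

end Unitary

/-! ### Induced representations -/

section Induced

variable {G : Type*} [Group G] [Fintype G]

/-- An element of the induced space is determined by its values on a transversal, and these are
arbitrary. -/
lemma card_mul_finrank_indSpace (L : Subgroup G) {U : Type*} [AddCommGroup U] [Module ℂ U]
    [FiniteDimensional ℂ U] (σ : Representation ℂ L U) :
    Nat.card L * Module.finrank ℂ (indSpace L σ) = Nat.card G * Module.finrank ℂ U := by
  have hmem : ∀ g : G, (Quotient.out (g : G ⧸ L))⁻¹ * g ∈ L := fun g =>
    QuotientGroup.eq.1 (Quotient.out_eq' (g : G ⧸ L))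
  let e : indSpace L σ ≃ₗ[ℂ] (G ⧸ L → U) :=
    { toFun := fun f x => f.1 x.out
      map_add' := fun _ _ => rfl
      map_smul' := fun _ _ => rfl
      invFun := fun φ => ⟨fun g => σ ⟨_, hmem g⟩⁻¹ (φ g), fun g k => by
        have hq : ((g * k.1 : G) : G ⧸ L) = g := QuotientGroup.mk_mul_of_mem g k.2
        have hk : (⟨_, hmem (g * k.1)⟩ : L) = ⟨_, hmem g⟩ * k := by
          ext
          simp only [hq, Subgroup.coe_mul, mul_assoc]
        change σ (⟨_, hmem (g * k.1)⟩ : L)⁻¹ (φ ((g * k.1 : G) : G ⧸ L)) =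
          σ k⁻¹ (σ (⟨_, hmem g⟩ : L)⁻¹ (φ (g : G ⧸ L)))
        rw [hk, hq, mul_inv_rev, map_mul]
        rfl⟩
      left_inv := fun f => by
        ext g
        change σ _ (f.1 _) = f.1 g
        rw [← f.2]
        simp
      right_inv := fun φ => by
        funext x
        have h1 : (⟨_, hmem x.out⟩ : L) = 1 := by
          ext
          simp
        change σ (⟨_, hmem x.out⟩ : L)⁻¹ (φ (x.out : G)) = φ x
        rw [h1]
        simp }
  rw [e.finrank_eq, Module.finrank_pi_fintype, Finset.sum_const, smul_eq_mul, ← mul_assoc,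
    Finset.card_univ, ← Nat.card_eq_fintype_card, mul_comm (Nat.card L),
    ← Subgroup.card_eq_card_quotient_mul_card_subgroup]

variable (K L : Subgroup G) {U : Type*}

/-- The function `h ↦ ∑ σ(h₀) u`, summed over the `h₀ ∈ L` with `h h₀ ∈ K`. It lies in `Ind_L^G σ`,
is left `K`-invariant and is supported on `K L`. -/
def orbitSum [AddCommGroup U] [Module ℂ U] (σ : Representation ℂ L U) (u : U) : indSpace L σ :=
  ⟨fun h => ∑ h₀ : L with h * h₀.1 ∈ K, σ h₀ u, fun g k => by
    rw [map_sum]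
    refine Finset.sum_bij' (fun h₀ _ => k * h₀) (fun h₀ _ => k⁻¹ * h₀) ?_ ?_ ?_ ?_ ?_
    · intro h₀; simp [mul_assoc]
    · intro h₀; simp [mul_assoc]
    · intro h₀ _; simp
    · intro h₀ _; simp
    · intro h₀ _
      rw [← Module.End.mul_apply, ← map_mul, inv_mul_cancel_left]⟩

lemma orbitSum_apply [AddCommGroup U] [Module ℂ U] (σ : Representation ℂ L U) (u : U) (h : G) :
    (orbitSum K L σ u).1 h = ∑ h₀ : L with h * h₀.1 ∈ K, σ h₀ u := rfl

lemma orbitSum_mul_left [AddCommGroup U] [Module ℂ U] (σ : Representation ℂ L U) (u : U) {k : G}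
    (hk : k ∈ K) (h : G) : (orbitSum K L σ u).1 (k * h) = (orbitSum K L σ u).1 h := by
  simp only [orbitSum_apply, mul_assoc, Subgroup.mul_mem_cancel_left K hk]

lemma orbitSum_of_mem [AddCommGroup U] [Module ℂ U] (σ : Representation ℂ L U) {u : U}
    (hu : ∀ k ∈ K.subgroupOf L, σ k u = u) {k : G} (hk : k ∈ K) :
    (orbitSum K L σ u).1 k = (Nat.card (K.subgroupOf L) : ℂ) • u := by
  rw [orbitSum_apply, Finset.sum_congr rfl (g := fun _ => u)]
  · rw [Finset.sum_const, Nat.cast_smul_eq_nsmul, Nat.card_eq_fintype_card,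
      Fintype.card_of_subtype]
    intro x
    simp [Subgroup.mul_mem_cancel_left K hk, Subgroup.mem_subgroupOf]
  · intro h₀ h
    refine hu _ ?_
    simpa [Subgroup.mul_mem_cancel_left K hk, Subgroup.mem_subgroupOf] using h

/-- Unitarity moves the sum that defines `orbitSum` onto the argument of `f`. -/
lemma sum_sp_orbitSum [NormedAddCommGroup U] [InnerProductSpace ℂ U] {σ : Representation ℂ L U}
    (hσ : IsUnitaryRep σ) (u : U) (f : indSpace L σ) (χ : G → ℂ)
    (hχ : ∀ (h : G) (l : L), χ (h * l) = χ h) (x : G) :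
    ∑ h : G, χ h * sp (f.1 h) ((orbitSum K L σ u).1 (x⁻¹ * h)) =
      Nat.card L * ∑ k : K, χ (x * k) * sp (f.1 (x * k)) u := by
  have h1 : ∀ h : G, χ h * sp (f.1 h) ((orbitSum K L σ u).1 (x⁻¹ * h)) =
      ∑ h₀ : L, if x⁻¹ * (h * h₀) ∈ K then χ (h * h₀) * sp (f.1 (h * h₀)) u else 0 := by
    intro h
    rw [orbitSum_apply, sp_sum_right, Finset.mul_sum, Finset.sum_filter]
    refine Finset.sum_congr rfl fun h₀ _ => ?_
    rw [mul_assoc, hχ, f.2, hσ.sp_apply_right]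
  have h2 : ∀ h₀ : L,
      (∑ h : G, if x⁻¹ * (h * h₀) ∈ K then χ (h * h₀) * sp (f.1 (h * h₀)) u else 0) =
        ∑ k : K, χ (x * k) * sp (f.1 (x * k)) u := by
    intro h₀
    refine (Fintype.sum_equiv (Equiv.mulRight (h₀ : G)) _
      (fun h => if x⁻¹ * h ∈ K then χ h * sp (f.1 h) u else 0) fun _ => rfl).trans ?_
    rw [← Fintype.sum_equiv (Equiv.mulLeft x)
        (fun h => if h ∈ K then χ (x * h) * sp (f.1 (x * h)) u else 0) _ (fun h => by simp),
      ← Finset.sum_filter]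
    exact Finset.sum_subtype _ (by simp) _
  rw [Finset.sum_congr rfl fun h _ => h1 h, Finset.sum_comm, Finset.sum_congr rfl fun h _ => h2 h,
    Finset.sum_const, nsmul_eq_mul, Finset.card_univ, Nat.card_eq_fintype_card]

/-- The scalar product of an induced representation is invariant. -/
lemma indInner_indRep [NormedAddCommGroup U] [InnerProductSpace ℂ U] (σ : Representation ℂ L U)
    (g : G) (f₁ f₂ : indSpace L σ) :
    indInner L σ (indRep L σ g f₁) f₂ = indInner L σ f₁ (indRep L σ g⁻¹ f₂) := by
  unfold indInner
  congr 1
  refine Fintype.sum_equiv (Equiv.mulLeft g⁻¹) _ _ fun x => ?_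
  change sp (f₁.1 (g⁻¹ * x)) (f₂.1 x) = sp (f₁.1 (g⁻¹ * x)) (f₂.1 (g⁻¹⁻¹ * (g⁻¹ * x)))
  simp

end Induced

/-! ### The semidirect product and the representation `W` -/

section SemidirectLemmas

variable {H A : Type*} [Group H] [AddCommGroup A] [DistribMulAction H A]

/-- The pair `(h, a)` of the semidirect product. -/
abbrev Semi.mk (h : H) (a : A) : Semi H A := ⟨Multiplicative.ofAdd a, h⟩

/-- The bijection of `K ⋉ C` with `K × C`. -/
def subSemiEquiv (K : Subgroup H) (C : AddSubgroup A) (hC : ∀ k ∈ K, ∀ c ∈ C, k • c ∈ C) :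
    subSemi K C hC ≃ K × C where
  toFun g := (⟨g.1.right, g.2.1⟩, ⟨g.1.left.toAdd, g.2.2⟩)
  invFun p := ⟨Semi.mk p.1.1 p.2.1, p.1.2, p.2.2⟩
  left_inv _ := rfl
  right_inv _ := rfl

lemma card_subSemi (K : Subgroup H) (C : AddSubgroup A) (hC : ∀ k ∈ K, ∀ c ∈ C, k • c ∈ C) :
    Nat.card (subSemi K C hC) = Nat.card K * Nat.card C := by
  rw [Nat.card_congr (subSemiEquiv K C hC), Nat.card_prod]

lemma card_inertia (ψ : AddChar A ℂ) :
    Nat.card (inertia (H := H) ψ) = Nat.card (charStab (H := H) ψ) * Nat.card A := by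
  refine (card_subSemi _ _ _).trans ?_
  congr 1
  exact Nat.card_congr (Equiv.Set.univ A)

lemma card_semi : Nat.card (Semi H A) = Nat.card H * Nat.card A := by
  rw [Nat.card_congr SemidirectProduct.equivProd, Nat.card_prod, mul_comm]
  rfl

lemma sum_semi [Fintype H] [Fintype A] {M : Type*} [AddCommMonoid M] (f : Semi H A → M) :
    ∑ g, f g = ∑ h : H, ∑ a : A, f (Semi.mk h a) := by
  rw [← Fintype.sum_prod_type' (f := fun h a => f (Semi.mk h a))]
  let e : Semi H A ≃ H × A :=
    { toFun := fun g => (g.right, g.left.toAdd)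
      invFun := fun p => Semi.mk p.1 p.2
      left_inv := fun _ => rfl
      right_inv := fun _ => rfl }
  exact Fintype.sum_equiv e _ _ fun g => rfl

variable {U : Type*}

lemma liftW_apply [Finite A] [AddCommGroup U] [Module ℂ U] (ψ : AddChar A ℂ)
    (σ : Representation ℂ (charStab (H := H) ψ) U) (f : indSpace (charStab ψ) σ) (g : Semi H A) :
    (liftW ψ σ f).1 g = ψ (g.right⁻¹ • g.left.toAdd) • f.1 g.right := rfl

lemma WRep_liftW_apply [Finite A] [AddCommGroup U] [Module ℂ U] (ψ : AddChar A ℂ)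
    (σ : Representation ℂ (charStab (H := H) ψ) U) (f : indSpace (charStab ψ) σ)
    (g x : Semi H A) :
    (WRep ψ σ g (liftW ψ σ f)).1 x =
      (ψ (x.right⁻¹ • x.left.toAdd) * starRingEnd ℂ (ψ (x.right⁻¹ • g.left.toAdd))) •
        f.1 (g.right⁻¹ * x.right) := by
  change (liftW ψ σ f).1 (g⁻¹ * x) = _
  have hl : (g⁻¹ * x).left.toAdd = g.right⁻¹ • (x.left.toAdd - g.left.toAdd) := by
    simp [actHom, sub_eq_neg_add]
  rw [liftW_apply, hl, SemidirectProduct.mul_right, SemidirectProduct.inv_right, mul_inv_rev,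
    inv_inv, mul_smul, smul_inv_smul, smul_sub, sub_eq_add_neg, AddChar.map_add_eq_mul,
    AddChar.map_neg_eq_conj]

variable [Fintype H] [Fintype A] [NormedAddCommGroup U] [InnerProductSpace ℂ U]
  {ψ : AddChar A ℂ} {σ : Representation ℂ (charStab (H := H) ψ) U}

/-- The characters `ʰψ(a')` of the two factors cancel, and the sum over `A` contributes `|A|`. -/
lemma WInner_liftW (f f' : indSpace (charStab ψ) σ) (g : Semi H A) :
    WInner ψ σ (liftW ψ σ f) (WRep ψ σ g (liftW ψ σ f')) =
      (Nat.card (charStab (H := H) ψ) : ℂ)⁻¹ *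
        ∑ h : H, ψ (h⁻¹ • g.left.toAdd) * sp (f.1 h) (f'.1 (g.right⁻¹ * h)) := by
  have hA : (Nat.card A : ℂ) ≠ 0 := Nat.cast_ne_zero.2 Nat.card_pos.ne'
  have h1 : ∀ (h : H) (a : A),
      sp ((liftW ψ σ f).1 (Semi.mk h a)) ((WRep ψ σ g (liftW ψ σ f')).1 (Semi.mk h a)) =
        ψ (h⁻¹ • g.left.toAdd) * sp (f.1 h) (f'.1 (g.right⁻¹ * h)) := by
    intro h a
    have hn : ψ (h⁻¹ • a) * starRingEnd ℂ (ψ (h⁻¹ • a)) = 1 := by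
      rw [← AddChar.map_neg_eq_conj, ← AddChar.map_add_eq_mul, add_neg_cancel,
        AddChar.map_zero_eq_one]
    rw [WRep_liftW_apply, liftW_apply, sp_smul_left, sp_smul_right]
    simp only [toAdd_ofAdd, map_mul, Complex.conj_conj]
    linear_combination (ψ (h⁻¹ • g.left.toAdd) * sp (f.1 h) (f'.1 (g.right⁻¹ * h))) * hn
  change (Nat.card (inertia (H := H) ψ) : ℂ)⁻¹ * _ = _
  rw [sum_semi, card_inertia]
  simp only [h1, Finset.sum_const, Finset.card_univ, nsmul_eq_mul, ← Nat.card_eq_fintype_card]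
  rw [← Finset.mul_sum, Nat.cast_mul, mul_inv, mul_assoc, inv_mul_cancel_left₀ hA]

/-- All matrix coefficients of the theorem reduce to this one. -/
lemma WInner_liftW_orbitSum (hσ : IsUnitaryRep σ) (K : Subgroup H) (u : U) (c : ℂ)
    (f : indSpace (charStab ψ) σ) (g : Semi H A) :
    WInner ψ σ (liftW ψ σ f) (WRep ψ σ g (liftW ψ σ (c • orbitSum K (charStab ψ) σ u))) =
      starRingEnd ℂ c *
        ∑ k : K, ψ ((g.right * k)⁻¹ • g.left.toAdd) * sp (f.1 (g.right * k)) u := by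
  have hL : (Nat.card (charStab (H := H) ψ) : ℂ) ≠ 0 := Nat.cast_ne_zero.2 Nat.card_pos.ne'
  have hχ : ∀ (h : H) (l : charStab (H := H) ψ),
      ψ ((h * l)⁻¹ • g.left.toAdd) = ψ (h⁻¹ • g.left.toAdd) := fun h l => by
    rw [mul_inv_rev, mul_smul, charStab_smul ((charStab ψ).inv_mem l.2)]
  have h1 := sum_sp_orbitSum K (charStab ψ) hσ u f (fun h => ψ (h⁻¹ • g.left.toAdd)) hχ g.right
  rw [WInner_liftW]
  have h2 : ∀ h : H, (c • orbitSum K (charStab ψ) σ u).1 h =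
    c • (orbitSum K (charStab ψ) σ u).1 h := fun _ => rfl
  simp only [h2, sp_smul_right, mul_left_comm _ (starRingEnd ℂ c)]
  rw [← Finset.mul_sum, h1, mul_left_comm, inv_mul_cancel_left₀ hL]

end SemidirectLemmas

/-! ### The homogeneous space -/

namespace FibreSystem

variable {H A Y : Type*} [Group H] [AddCommGroup A] [DistribMulAction H A]
  [MulAction H Y] {B : Y → Type*} [∀ y, AddCommGroup (B y)] (S : FibreSystem H A Y B)

lemma pt_proj_eq_iff {y y' : Y} {a a' : A} :
    S.pt y (S.proj y a) = S.pt y' (S.proj y' a') ↔ y = y' ∧ S.proj y a = S.proj y a' := by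
  constructor
  · intro h
    obtain rfl : y = y' := congrArg Sigma.fst h
    exact ⟨rfl, eq_of_heq (Sigma.mk.inj h).2⟩
  · rintro ⟨rfl, h⟩
    rw [h]

lemma smul_base (y₀ : Y) (g : Semi H A) :
    g • S.base y₀ = S.pt (g.right • y₀) (S.proj (g.right • y₀) g.left.toAdd) := by
  rw [base, ← map_zero (S.proj y₀), smul_pt_proj, smul_zero, add_zero]

lemma smul_base_eq_iff (y₀ : Y) (g : Semi H A) : g • S.base y₀ = S.base y₀ ↔ g ∈ S.KC y₀ := by
  rw [smul_base, base, ← map_zero (S.proj y₀), pt_proj_eq_iff]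
  change _ ↔ g.right • y₀ = y₀ ∧ S.proj y₀ g.left.toAdd = 0
  refine and_congr_right fun h => ?_
  rw [h, map_zero]

lemma exists_smul_base [MulAction.IsPretransitive H Y] (y₀ : Y) (x : S.Total) :
    ∃ g : Semi H A, g • S.base y₀ = x := by
  obtain ⟨y, a, rfl⟩ := S.exists_eq_pt x
  obtain ⟨h, rfl⟩ := MulAction.exists_smul_eq H y₀ y
  exact ⟨Semi.mk h a, S.smul_base y₀ _⟩

/-- A right `K ⋉ C`-invariant function on `H ⋉ A` descends to `X`. -/
lemma exists_toGroup_eq [MulAction.IsPretransitive H Y] (y₀ : Y) (φ : Semi H A → ℂ)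
    (hφ : ∀ g, ∀ s ∈ S.KC y₀, φ (g * s) = φ g) :
    ∃ Φ : S.Total → ℂ, toGroup (G := Semi H A) (S.base y₀) Φ = φ := by
  choose r hr using S.exists_smul_base y₀ (H := H)
  refine ⟨fun x => φ (r x), funext fun g => ?_⟩
  have hs : g⁻¹ * r (g • S.base y₀) ∈ S.KC y₀ := by
    rw [← smul_base_eq_iff, mul_smul, hr, inv_smul_smul]
  have := hφ g _ hs
  rwa [mul_inv_cancel_left] at this

lemma toGroup_injective [MulAction.IsPretransitive H Y] (y₀ : Y) :
    Function.Injective (toGroup (G := Semi H A) (S.base y₀)) := by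
  intro Φ Φ' h
  funext x
  obtain ⟨g, rfl⟩ := S.exists_smul_base y₀ x
  exact congrFun h g

lemma sharp_pt_proj (p : S.Dual) (y : Y) (a : A) :
    S.sharp p (S.pt y (S.proj y a)) = if y = p.1 then p.2 (S.proj p.1 a) else 0 := by
  obtain ⟨z, χ⟩ := p
  by_cases h : y = z
  · subst h
    simp [sharp, pt]
  · simp [sharp, pt, h]

lemma smul_dpt_apply {y₀ : Y} {θ : AddChar (B y₀) ℂ} (h : H) (a : A) :
    (h • S.dpt y₀ θ).2 (S.proj (h • S.dpt y₀ θ).1 a) = S.infl y₀ θ (h⁻¹ • a) :=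
  S.smul_dual_apply h (S.dpt y₀ θ) a

lemma smul_dpt_eq_iff {y₀ : Y} {θ : AddChar (B y₀) ℂ} {h h' : H} :
    h • S.dpt y₀ θ = h' • S.dpt y₀ θ ↔
      h • y₀ = h' • y₀ ∧ ∀ a, S.infl y₀ θ (h⁻¹ • a) = S.infl y₀ θ (h'⁻¹ • a) := by
  constructor
  · intro hh
    refine ⟨congrArg Sigma.fst hh, fun a => ?_⟩
    rw [← smul_dpt_apply, ← smul_dpt_apply, hh]
  · rintro ⟨h1, h2⟩
    refine S.dual_ext h1 fun a => ?_
    rw [smul_dpt_apply, smul_dpt_apply, h2]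

/-- The stabilizer in `H` of `θ`, as a character of `B_{y₀}`, is `K_θ`. -/
lemma smul_dpt_eq_self_iff {y₀ : Y} {θ : AddChar (B y₀) ℂ} {h : H} :
    h • S.dpt y₀ θ = S.dpt y₀ θ ↔ h ∈ MulAction.stabilizer H y₀ ∧ h ∈ S.Hst y₀ θ := by
  have := S.smul_dpt_eq_iff (θ := θ) (h := h) (h' := 1)
  rw [one_smul] at this
  rw [this, one_smul, inv_one]
  simp only [one_smul]
  rfl

lemma infl_of_mem_C {y₀ : Y} {θ : AddChar (B y₀) ℂ} {c : A} (hc : c ∈ S.C y₀) :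
    S.infl y₀ θ c = 1 := by
  change θ (S.proj y₀ c) = 1
  rw [show S.proj y₀ c = 0 from hc, AddChar.map_zero_eq_one]

/-- On the characters that are trivial on the image of `C`, the average over `C` in `Λ` acts
trivially, and only the sum over `K` is left. -/
lemma Lam_pt_proj [Fintype H] [Fintype A] {y₀ : Y} {p : S.Dual} (hp : p ∈ S.dual0 y₀)
    (y : Y) (a : A) :
    S.Lam y₀ p (S.pt y (S.proj y a)) =
      (Nat.card (Kpt (H := H) y₀ p.1) : ℂ)⁻¹ *
        ∑ k : MulAction.stabilizer H y₀,
          if y = (k : H) • p.1 then p.2 (S.proj p.1 ((k : H)⁻¹ • a)) else 0 := by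
  have hC : (Nat.card (S.C y₀) : ℂ) ≠ 0 := Nat.cast_ne_zero.2 Nat.card_pos.ne'
  have h1 : ∀ g : S.KC y₀, permRep (Semi H A) S.Total g.1 (S.sharp p) (S.pt y (S.proj y a)) =
      if y = g.1.right • p.1 then p.2 (S.proj p.1 (g.1.right⁻¹ • a)) else 0 := by
    intro g
    change S.sharp p (g.1⁻¹ • S.pt y (S.proj y a)) = _
    rw [smul_pt_proj, sharp_pt_proj, SemidirectProduct.inv_right]
    refine if_congr inv_smul_eq_iff ?_ rfl
    have h3 : (g.1⁻¹).left.toAdd ∈ S.C y₀ := ((S.KC y₀).inv_mem g.2).2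
    rw [map_add, AddChar.map_add_eq_mul, hp _ h3, one_mul]
  rw [Lam, Pi.smul_apply, Finset.sum_apply, smul_eq_mul]
  simp only [h1]
  have h4 : (∑ g : S.KC y₀,
      if y = g.1.right • p.1 then p.2 (S.proj p.1 (g.1.right⁻¹ • a)) else 0) =
      ∑ q : MulAction.stabilizer H y₀ × S.C y₀,
        if y = (q.1 : H) • p.1 then p.2 (S.proj p.1 ((q.1 : H)⁻¹ • a)) else 0 :=
    Fintype.sum_equiv (subSemiEquiv _ _ (S.smul_mem_C y₀)) _ _ fun _ => rfl
  rw [h4, Fintype.sum_prod_type]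
  simp only [Finset.sum_const, Finset.card_univ, nsmul_eq_mul, ← Nat.card_eq_fintype_card]
  rw [← Finset.mul_sum, mul_inv, mul_assoc, inv_mul_cancel_left₀ hC]

end FibreSystem

/-! ### Sums over cosets and double cosets -/

section Counting

variable {G : Type*} [Group G] (K : Subgroup G)

lemma card_subgroupOf (L : Subgroup G) :
    Nat.card (K.subgroupOf L) = Nat.card (K ⊓ L : Subgroup G) := by
  rw [← Subgroup.inf_subgroupOf_right]
  exact Nat.card_congr (Subgroup.subgroupOfEquivOfLe inf_le_right).toEquiv

variable [Fintype G]

lemma sum_subgroup_eq_sum_ite [Fintype K] (f : G → ℂ) : ∑ k : K, f k = ∑ h : G, if h ∈ K then f h else 0 := by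
  rw [← Finset.sum_filter]
  exact (Finset.sum_subtype _ (by simp) _).symm

lemma sum_ite_mem_const (c : ℂ) : (∑ h : G, if h ∈ K then c else 0) = Nat.card K * c := by
  rw [← sum_subgroup_eq_sum_ite K fun _ => c, Finset.sum_const, nsmul_eq_mul, Finset.card_univ,
    Nat.card_eq_fintype_card]

lemma sum_subgroup_ite_mem [Fintype K] (L : Subgroup G) [DecidablePred (· ∈ L)] (c : ℂ) :
    (∑ k : K, if (k : G) ∈ L then c else 0) = Nat.card (K ⊓ L : Subgroup G) * c := by
  rw [← sum_ite_mem_const, sum_subgroup_eq_sum_ite K fun h => if h ∈ L then c else 0]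
  refine Finset.sum_congr rfl fun h _ => ?_
  by_cases h1 : h ∈ K <;> by_cases h2 : h ∈ L <;> simp [h1, h2]

end Counting

namespace FibreSystem

variable {H A Y : Type*} [Group H] [AddCommGroup A] [DistribMulAction H A]
  [MulAction H Y] {B : Y → Type*} [∀ y, AddCommGroup (B y)] {S : FibreSystem H A Y B}
  {y₀ : Y} {θ : AddChar (B y₀) ℂ}

lemma smul_dpt_mem_dual0 (l : S.Hst y₀ θ) : (l : H) • S.dpt y₀ θ ∈ S.dual0 y₀ := by
  intro c hc
  rw [smul_dpt_apply, charStab_smul ((S.Hst y₀ θ).inv_mem l.2), infl_of_mem_C S hc]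

variable [Fintype H]

/-- `K_θ` is the stabilizer of `θ`. -/
lemma sum_ite_smul_dpt_eq (c : ℂ) :
    (∑ h : H, if h • S.dpt y₀ θ = S.dpt y₀ θ then c else 0) = Nat.card (S.Kst y₀ θ) * c := by
  simp only [smul_dpt_eq_self_iff, ← Subgroup.mem_inf]
  rw [sum_ite_mem_const, card_subgroupOf]

lemma sum_Hst_ite_smul_dpt_eq (c : ℂ) :
    (∑ l : S.Hst y₀ θ, if (l : H) • S.dpt y₀ θ = S.dpt y₀ θ then c else 0) =
      Nat.card (S.Kst y₀ θ) * c := by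
  rw [← sum_ite_mem_const]
  refine Finset.sum_congr rfl fun l _ => if_congr ?_ rfl rfl
  rw [smul_dpt_eq_self_iff, Subgroup.mem_subgroupOf]
  exact and_iff_left l.2

lemma sum_stabilizer_ite_mem_Hst (c : ℂ) :
    (∑ k : MulAction.stabilizer H y₀, if (k : H) ∈ S.Hst y₀ θ then c else 0) =
      Nat.card (S.Kst y₀ θ) * c := by
  rw [sum_subgroup_ite_mem, card_subgroupOf]

/-- The elements of `K` that move `q` to `p` form a coset of `K_p`. -/
lemma sum_stabilizer_ite_smul_eq {p q : S.Dual}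
    (hpq : ∃ k ∈ MulAction.stabilizer H y₀, k • q = p) (c : ℂ) :
    (∑ k : MulAction.stabilizer H y₀, if (k : H) • q = p then c else 0) =
      Nat.card (S.Kch (H := H) y₀ p) * c := by
  obtain ⟨k₀, hk₀, rfl⟩ := hpq
  rw [Kch, ← sum_subgroup_ite_mem]
  refine (Fintype.sum_equiv (Equiv.mulRight ⟨k₀, hk₀⟩) _ _ fun k => ?_).symm
  refine if_congr ?_ rfl rfl
  rw [MulAction.mem_stabilizer_iff]
  simp [mul_smul]

/-- The pairs `(k, l)` with `k l θ = l₀ θ` have `k ∈ K_θ` and `l ∈ k⁻¹ l₀ K_θ`. -/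
lemma sum_sum_ite_smul_dpt_eq {M : S.Hst y₀ θ → ℂ}
    (hl : ∀ m ∈ S.Kst y₀ θ, ∀ l, M (m * l) = M l) (hr : ∀ m ∈ S.Kst y₀ θ, ∀ l, M (l * m) = M l)
    {k₀ : H} (hk₀ : k₀ ∈ MulAction.stabilizer H y₀) (l₀ : S.Hst y₀ θ) :
    (∑ l : S.Hst y₀ θ, ∑ k : MulAction.stabilizer H y₀,
      if (k : H) • (l : H) • S.dpt y₀ θ = (k₀ * (l₀ : H)) • S.dpt y₀ θ then M l else 0) =
      (Nat.card (S.Kst y₀ θ) : ℂ) ^ 2 * M l₀ := by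
  have h1 : ∀ k : MulAction.stabilizer H y₀,
      (∑ l : S.Hst y₀ θ,
        if (k : H) • (l : H) • S.dpt y₀ θ = (l₀ : H) • S.dpt y₀ θ then M l else 0) =
      if (k : H) ∈ S.Hst y₀ θ then Nat.card (S.Kst y₀ θ) * M l₀ else 0 := by
    intro k
    split_ifs with hk
    · rw [← sum_Hst_ite_smul_dpt_eq]
      have hk' : (⟨k, hk⟩ : S.Hst y₀ θ)⁻¹ ∈ S.Kst y₀ θ :=
        (S.Kst y₀ θ).inv_mem (Subgroup.mem_subgroupOf.2 k.2)
      refine (Fintype.sum_equiv (Equiv.mulLeft ((⟨k, hk⟩ : S.Hst y₀ θ)⁻¹ * l₀)) _ _ fun l => ?_).symm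
      have h2 : (k : H) • ((Equiv.mulLeft ((⟨k, hk⟩ : S.Hst y₀ θ)⁻¹ * l₀)) l : H) • S.dpt y₀ θ =
          (l₀ : H) • (l : H) • S.dpt y₀ θ := by
        simp [mul_smul]
      rw [h2]
      by_cases hs : (l : H) • S.dpt y₀ θ = S.dpt y₀ θ
      · rw [if_pos hs, if_pos (by rw [hs]), Equiv.coe_mulLeft]
        beta_reduce
        rw [mul_assoc, hl _ hk', hr]
        exact Subgroup.mem_subgroupOf.2 (S.smul_dpt_eq_self_iff.1 hs).1
      · rw [if_neg hs, if_neg fun h => hs (MulAction.injective _ h)]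
    -- As `l` and `l₀` fix `ψ`, so does every `k` with `k l θ = l₀ θ`.
    · refine Finset.sum_eq_zero fun l _ => if_neg fun h => hk fun a => ?_
      rw [← mul_smul, smul_dpt_eq_iff] at h
      have h2 := h.2 a
      rwa [mul_inv_rev, mul_smul, charStab_smul ((S.Hst y₀ θ).inv_mem l.2),
        charStab_smul ((S.Hst y₀ θ).inv_mem l₀.2)] at h2
  rw [Finset.sum_comm, ← Fintype.sum_equiv (Equiv.mulLeft ⟨k₀, hk₀⟩)
    (fun k : MulAction.stabilizer H y₀ => ∑ l : S.Hst y₀ θ,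
      if (k : H) • (l : H) • S.dpt y₀ θ = (l₀ : H) • S.dpt y₀ θ then M l else 0) _ fun k => by
        simp [mul_smul]]
  rw [Finset.sum_congr rfl fun k _ => h1 k, sum_stabilizer_ite_mem_Hst, pow_two, mul_assoc]

variable [Fintype Y] [∀ y, Fintype (B y)]

/-- The set `Γ_θ` parametrizes the double cosets of `K_θ` in `H_θ`, and the double coset that
belongs to `p` has `|K_θ|² / |K_p|` elements. -/
lemma sum_biinvariant {Γ : Set S.Dual} (hΓ : S.IsTransversal (H := H) y₀ Γ) {M : S.Hst y₀ θ → ℂ}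
    (hl : ∀ m ∈ S.Kst y₀ θ, ∀ l, M (m * l) = M l) (hr : ∀ m ∈ S.Kst y₀ θ, ∀ l, M (l * m) = M l)
    (l₀ : S.Dual → S.Hst y₀ θ)
    (hl₀ : ∀ p ∈ S.GammaTheta (H := H) y₀ Γ θ, ∃ k ∈ MulAction.stabilizer H y₀,
      p = (k * (l₀ p : H)) • S.dpt y₀ θ) :
    ∑ l, M l = (Nat.card (S.Kst y₀ θ) : ℂ) ^ 2 *
      ∑ p : S.Dual with p ∈ S.GammaTheta (H := H) y₀ Γ θ,
        (Nat.card (S.Kch (H := H) y₀ p) : ℂ)⁻¹ * M (l₀ p) := by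
  have h1 : ∀ p ∈ S.GammaTheta (H := H) y₀ Γ θ,
      (Nat.card (S.Kst y₀ θ) : ℂ) ^ 2 * ((Nat.card (S.Kch (H := H) y₀ p) : ℂ)⁻¹ * M (l₀ p)) =
      ∑ l : S.Hst y₀ θ, if ∃ k ∈ MulAction.stabilizer H y₀, k • (l : H) • S.dpt y₀ θ = p
        then M l else 0 := by
    intro p hp
    obtain ⟨k₀, hk₀, h2⟩ := hl₀ p hp
    have hc : (Nat.card (S.Kch (H := H) y₀ p) : ℂ) ≠ 0 := Nat.cast_ne_zero.2 Nat.card_pos.ne'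
    rw [mul_left_comm, ← sum_sum_ite_smul_dpt_eq hl hr hk₀ (l₀ p), Finset.mul_sum]
    refine Finset.sum_congr rfl fun l _ => ?_
    rw [← h2]
    split_ifs with h3
    · rw [sum_stabilizer_ite_smul_eq h3, inv_mul_cancel_left₀ hc]
    · have h4 : ∀ k : MulAction.stabilizer H y₀, ¬ (k : H) • (l : H) • S.dpt y₀ θ = p :=
        fun k h => h3 ⟨k, k.2, h⟩
      simp [h4]
  rw [Finset.mul_sum, Finset.sum_congr rfl fun p hp => h1 p (Finset.mem_filter.1 hp).2,
    Finset.sum_comm]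
  refine Finset.sum_congr rfl fun l _ => ?_
  -- Exactly one `p ∈ Γ_θ` lies in the `K`-orbit of `ˡθ`.
  obtain ⟨p, ⟨hpΓ, k, hk, hkp⟩, huniq⟩ := hΓ.2 _ (smul_dpt_mem_dual0 l)
  have hk' := (MulAction.stabilizer H y₀).inv_mem hk
  have hp : p = k⁻¹ • (l : H) • S.dpt y₀ θ := by rw [← hkp, inv_smul_smul]
  rw [Finset.sum_eq_single_of_mem p, if_pos ⟨k⁻¹, hk', hp.symm⟩]
  · refine Finset.mem_filter.2 ⟨Finset.mem_univ _, hpΓ, k⁻¹, hk', l, l.2, ?_⟩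
    rw [hp, mul_smul]
  · intro q hq hqp
    refine if_neg ?_
    rintro ⟨k₁, hk₁, rfl⟩
    refine hqp (huniq _ ⟨(Finset.mem_filter.1 hq).2.1, k₁⁻¹,
      (MulAction.stabilizer H y₀).inv_mem hk₁, ?_⟩)
    rw [inv_smul_smul]

/-- The fibres of `h ↦ ʰθ` are the left cosets of `K_θ` in `H`. -/
lemma sum_eq_sum_dualTheta {P : H → ℂ}
    (hP : ∀ h, ∀ m ∈ S.Kst y₀ θ, P (h * (m : H)) = P h) (y : Y)
    (h : S.Dual → H) (hh : ∀ p ∈ S.dualTheta (H := H) y₀ θ, h p • S.dpt y₀ θ = p) :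
    (∑ x : H, if x • y₀ = y then P x else 0) = Nat.card (S.Kst y₀ θ) *
      ∑ p : S.Dual with p ∈ S.dualTheta (H := H) y₀ θ, if p.1 = y then P (h p) else 0 := by
  have h1 : ∀ p ∈ S.dualTheta (H := H) y₀ θ,
      (Nat.card (S.Kst y₀ θ) : ℂ) * (if p.1 = y then P (h p) else 0) =
        ∑ x : H, if x • S.dpt y₀ θ = p then (if x • y₀ = y then P x else 0) else 0 := by
    intro p hp
    rw [← sum_ite_smul_dpt_eq]
    refine Fintype.sum_equiv (Equiv.mulLeft (h p)) _ _ fun x => ?_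
    rw [Equiv.coe_mulLeft]
    beta_reduce
    by_cases hx : x • S.dpt y₀ θ = S.dpt y₀ θ
    · have hx' := S.smul_dpt_eq_self_iff.1 hx
      have h2 : (h p * x) • y₀ = p.1 := by
        rw [mul_smul, MulAction.mem_stabilizer_iff.1 hx'.1]
        exact congrArg Sigma.fst (hh p hp)
      rw [if_pos hx, if_pos (show (h p * x) • S.dpt y₀ θ = p by rw [mul_smul, hx, hh p hp]), h2,
        hP (h p) ⟨x, hx'.2⟩ (Subgroup.mem_subgroupOf.2 hx'.1)]
    · rw [if_neg hx, if_neg fun h2 => hx (MulAction.injective (h p)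
        ((mul_smul _ _ _).symm.trans (h2.trans (hh p hp).symm)))]
  rw [Finset.mul_sum, Finset.sum_congr rfl fun p hp => h1 p (Finset.mem_filter.1 hp).2,
    Finset.sum_comm]
  refine Finset.sum_congr rfl fun x _ => ?_
  rw [Finset.sum_ite_eq]
  exact (if_pos (Finset.mem_filter.2 ⟨Finset.mem_univ _, x, rfl⟩)).symm

end FibreSystem

namespace FibreSystem

/-! ### The invariant vector -/

section InvariantVector

variable {H A Y : Type*} [Group H] [AddCommGroup A]
  [DistribMulAction H A] [MulAction H Y] {B : Y → Type*} [∀ y, AddCommGroup (B y)]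
  (S : FibreSystem H A Y B) (y₀ : Y) (θ : AddChar (B y₀) ℂ)

/-- The normalizing factor `√(|K| |K_θ|)` of the vector `F_{θ,j}`. -/
def normFactor : ℝ :=
  Real.sqrt (Nat.card (MulAction.stabilizer H y₀) * Nat.card (S.Kst y₀ θ))

lemma normFactor_mul_self : (S.normFactor y₀ θ : ℂ) * S.normFactor y₀ θ =
    Nat.card (MulAction.stabilizer H y₀) * Nat.card (S.Kst y₀ θ) := by
  rw [← Complex.ofReal_mul, normFactor, Real.mul_self_sqrt (by positivity)]
  push_cast
  rfl

variable [Fintype H] [Fintype A] {U : Type*} [NormedAddCommGroup U] [InnerProductSpace ℂ U]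
  (σ : Representation ℂ (S.Hst y₀ θ) U) (u : U)

/-- The vector `F_{θ,j}` of `W`, as the lift `F_f` of a multiple `f` of `orbitSum`. -/
def invVec : WSpace (S.infl y₀ θ) σ :=
  liftW (S.infl y₀ θ) σ
    ((S.normFactor y₀ θ : ℂ)⁻¹ • orbitSum (MulAction.stabilizer H y₀) (S.Hst y₀ θ) σ u)

variable {σ u}

lemma invVec_coe [FiniteDimensional ℂ U] (hσ : IsUnitaryRep σ) :
    (S.invVec y₀ θ σ u).1 = S.sphVec y₀ θ σ u := by
  funext g
  change S.infl y₀ θ (g.right⁻¹ • g.left.toAdd) • (S.normFactor y₀ θ : ℂ)⁻¹ •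
    (orbitSum (MulAction.stabilizer H y₀) (S.Hst y₀ θ) σ u).1 g.right = _
  rw [smul_smul, ← div_eq_mul_inv, orbitSum_apply, sphVec]
  congr 1
  refine Finset.sum_congr (by ext; simp) fun h₀ _ => (hσ.adjoint_inv h₀ u).symm

/-- `K` acts trivially because `orbitSum` is left `K`-invariant, and `C` acts trivially because
`orbitSum` is supported on `K H_θ` and `C` is `K`-invariant and contained in the kernel of `ψ`. -/
lemma WRep_invVec_of_mem {g : Semi H A} (hg : g ∈ S.KC y₀) :
    WRep (S.infl y₀ θ) σ g (S.invVec y₀ θ σ u) = S.invVec y₀ θ σ u := by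
  refine Subtype.ext (funext fun x => ?_)
  rw [invVec, WRep_liftW_apply, liftW_apply]
  change _ • (S.normFactor y₀ θ : ℂ)⁻¹ •
      (orbitSum (MulAction.stabilizer H y₀) (S.Hst y₀ θ) σ u).1 (g.right⁻¹ * x.right) =
    _ • (S.normFactor y₀ θ : ℂ)⁻¹ •
      (orbitSum (MulAction.stabilizer H y₀) (S.Hst y₀ θ) σ u).1 x.right
  rw [orbitSum_mul_left _ _ _ _ (inv_mem hg.1)]
  by_cases h0 : ∃ l : S.Hst y₀ θ, x.right * l ∈ MulAction.stabilizer H y₀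
  · obtain ⟨l, hl⟩ := h0
    have h1 : S.infl y₀ θ (x.right⁻¹ • g.left.toAdd) = 1 := by
      rw [← charStab_smul ((S.Hst y₀ θ).inv_mem l.2), ← mul_smul, ← mul_inv_rev]
      exact S.infl_of_mem_C (S.smul_mem_C y₀ _ (inv_mem hl) _ hg.2)
    rw [h1, map_one, mul_one]
  · have h1 : (orbitSum (MulAction.stabilizer H y₀) (S.Hst y₀ θ) σ u).1 x.right = 0 := by
      rw [orbitSum_apply]
      refine Finset.sum_eq_zero fun l hl => (h0 ⟨l, ?_⟩).elim
      exact (Finset.mem_filter.1 hl).2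
    rw [h1, smul_zero, smul_zero, smul_zero]

lemma WInner_WRep_invVec (hσ : IsUnitaryRep σ) (f : indSpace (S.Hst y₀ θ) σ) (g : Semi H A) :
    WInner (S.infl y₀ θ) σ (liftW (S.infl y₀ θ) σ f)
        (WRep (S.infl y₀ θ) σ g (S.invVec y₀ θ σ u)) =
      (S.normFactor y₀ θ : ℂ)⁻¹ * ∑ h : H, if h • y₀ = g.right • y₀ then
        S.infl y₀ θ (h⁻¹ • g.left.toAdd) * sp (f.1 h) u else 0 := by
  rw [invVec, WInner_liftW_orbitSum hσ, map_inv₀, Complex.conj_ofReal]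
  congr 1
  rw [sum_subgroup_eq_sum_ite _ fun h =>
    S.infl y₀ θ ((g.right * h)⁻¹ • g.left.toAdd) * sp (f.1 (g.right * h)) u]
  refine Fintype.sum_equiv (Equiv.mulLeft g.right) _ _ fun h => if_congr ?_ rfl rfl
  rw [Equiv.coe_mulLeft, mul_smul]
  exact (MulAction.injective g.right).eq_iff.symm

lemma WInner_invVec_self (hσ : IsUnitaryRep σ) (hu : ‖u‖ = 1)
    (hinv : ∀ k ∈ S.Kst y₀ θ, σ k u = u) :
    WInner (S.infl y₀ θ) σ (S.invVec y₀ θ σ u) (S.invVec y₀ θ σ u) = 1 := by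
  have hK : (Nat.card (MulAction.stabilizer H y₀) : ℂ) ≠ 0 := Nat.cast_ne_zero.2 Nat.card_pos.ne'
  have hKs : (Nat.card (S.Kst y₀ θ) : ℂ) ≠ 0 := Nat.cast_ne_zero.2 Nat.card_pos.ne'
  have h1 := S.WInner_WRep_invVec y₀ θ (u := u) hσ
    ((S.normFactor y₀ θ : ℂ)⁻¹ • orbitSum (MulAction.stabilizer H y₀) (S.Hst y₀ θ) σ u) 1
  rw [map_one] at h1
  have h2 : ∀ h : H, (if h • y₀ = (1 : Semi H A).right • y₀ then
      S.infl y₀ θ (h⁻¹ • (1 : Semi H A).left.toAdd) * sp (((S.normFactor y₀ θ : ℂ)⁻¹ •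
        orbitSum (MulAction.stabilizer H y₀) (S.Hst y₀ θ) σ u).1 h) u else 0) =
      if h ∈ MulAction.stabilizer H y₀ then
        (S.normFactor y₀ θ : ℂ)⁻¹ * Nat.card (S.Kst y₀ θ) else 0 := by
    intro h
    rw [SemidirectProduct.one_right, SemidirectProduct.one_left, one_smul, toAdd_one, smul_zero,
      AddChar.map_zero_eq_one, one_mul]
    by_cases hh : h • y₀ = y₀
    · rw [if_pos hh, if_pos (MulAction.mem_stabilizer_iff.2 hh)]
      change sp ((S.normFactor y₀ θ : ℂ)⁻¹ •
        (orbitSum (MulAction.stabilizer H y₀) (S.Hst y₀ θ) σ u).1 h) u = _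
      rw [orbitSum_of_mem _ _ _ hinv (MulAction.mem_stabilizer_iff.2 hh), sp_smul_left,
        sp_smul_left, sp_self_eq_one hu, mul_one]
    · rw [if_neg hh, if_neg (mt MulAction.mem_stabilizer_iff.1 hh)]
  have h3 : (∑ h : H, if h ∈ MulAction.stabilizer H y₀ then
      (S.normFactor y₀ θ : ℂ)⁻¹ * Nat.card (S.Kst y₀ θ) else 0) =
      Nat.card (MulAction.stabilizer H y₀) *
        ((S.normFactor y₀ θ : ℂ)⁻¹ * Nat.card (S.Kst y₀ θ)) := by
    rw [← sum_ite_mem_const]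
    exact Finset.sum_congr rfl fun h _ => if_congr Iff.rfl rfl rfl
  refine h1.trans ?_
  rw [Finset.sum_congr rfl fun h _ => h2 h, h3]
  have h4 := S.normFactor_mul_self y₀ θ
  have h5 : (S.normFactor y₀ θ : ℂ) ≠ 0 := fun h => by
    rw [h, zero_mul] at h4
    exact mul_ne_zero hK hKs h4.symm
  field_simp
  rw [pow_two, h4]

end InvariantVector

/-! ### The spherical function -/

section Spherical

variable {H A Y : Type*} [Group H] [AddCommGroup A] [DistribMulAction H A] [MulAction H Y]
  {B : Y → Type*} [∀ y, AddCommGroup (B y)] (S : FibreSystem H A Y B) {y₀ : Y}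
  {θ : AddChar (B y₀) ℂ}

variable {U : Type*} [NormedAddCommGroup U] [InnerProductSpace ℂ U]
  {σ : Representation ℂ (S.Hst y₀ θ) U} {u : U}

lemma sphFun_mul_left (hσ : IsUnitaryRep σ) (hinv : ∀ k ∈ S.Kst y₀ θ, σ k u = u)
    {m : S.Hst y₀ θ} (hm : m ∈ S.Kst y₀ θ) (l : S.Hst y₀ θ) :
    sphFun sp σ u (m * l) = sphFun sp σ u l := by
  change sp u (σ (m * l) u) = sp u (σ l u)
  rw [map_mul, Module.End.mul_apply, hσ.sp_apply_right, hinv _ ((S.Kst y₀ θ).inv_mem hm)]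

lemma sphFun_mul_right (hinv : ∀ k ∈ S.Kst y₀ θ, σ k u = u)
    {m : S.Hst y₀ θ} (hm : m ∈ S.Kst y₀ θ) (l : S.Hst y₀ θ) :
    sphFun sp σ u (l * m) = sphFun sp σ u l := by
  change sp u (σ (l * m) u) = sp u (σ l u)
  rw [map_mul, Module.End.mul_apply, hinv _ hm]

variable [Fintype H]

/-- The sum of `ψ(k⁻¹ a)` over the `k ∈ K` with `k l y₀ = y`. Up to a factor these are the values
of `Λ_{z,χ}` at `(y, π_y(a))`, where `(z, χ)` is in the `K`-orbit of `(l y₀, ˡθ)`. -/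
def orbitCharSum (θ : AddChar (B y₀) ℂ) (y : Y) (a : A) (l : S.Hst y₀ θ) : ℂ :=
  ∑ k : MulAction.stabilizer H y₀,
    if y = ((k : H) * l) • y₀ then S.infl y₀ θ ((k : H)⁻¹ • a) else 0

lemma orbitCharSum_mul_left (y : Y) (a : A) {m : S.Hst y₀ θ} (hm : m ∈ S.Kst y₀ θ)
    (l : S.Hst y₀ θ) : S.orbitCharSum θ y a (m * l) = S.orbitCharSum θ y a l := by
  have hm' := Subgroup.mem_subgroupOf.1 hm
  refine Fintype.sum_equiv (Equiv.mulRight ⟨m, hm'⟩) _ _ fun k => ?_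
  have h1 : ((Equiv.mulRight (⟨m, hm'⟩ : MulAction.stabilizer H y₀)) k : H) = k * m := rfl
  rw [h1, Subgroup.coe_mul, mul_assoc, mul_inv_rev, mul_smul (m : H)⁻¹,
    charStab_smul ((S.Hst y₀ θ).inv_mem m.2)]

lemma orbitCharSum_mul_right (y : Y) (a : A) {m : S.Hst y₀ θ} (hm : m ∈ S.Kst y₀ θ)
    (l : S.Hst y₀ θ) : S.orbitCharSum θ y a (l * m) = S.orbitCharSum θ y a l := by
  have hm' := MulAction.mem_stabilizer_iff.1 (Subgroup.mem_subgroupOf.1 hm)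
  have h1 : ∀ k : H, (k * (l * m : S.Hst y₀ θ)) • y₀ = (k * l) • y₀ := fun k => by
    rw [Subgroup.coe_mul, ← mul_assoc, mul_smul _ (m : H), hm']
  simp only [orbitCharSum, h1]

variable [Fintype A]

lemma Lam_eq_orbitCharSum {p : S.Dual} {k₀ : H} (hk₀ : k₀ ∈ MulAction.stabilizer H y₀)
    {l : S.Hst y₀ θ} (hp : p = (k₀ * (l : H)) • S.dpt y₀ θ) (hp0 : p ∈ S.dual0 y₀)
    (y : Y) (a : A) :
    S.Lam y₀ p (S.pt y (S.proj y a)) =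
      (Nat.card (Kpt (H := H) y₀ p.1) : ℂ)⁻¹ * S.orbitCharSum θ y a l := by
  rw [S.Lam_pt_proj hp0]
  congr 1
  have hp1 : p.1 = (k₀ * (l : H)) • y₀ := by rw [hp]; rfl
  have hp2 : ∀ b, p.2 (S.proj p.1 b) = S.infl y₀ θ (k₀⁻¹ • b) := by
    intro b
    rw [hp, smul_dpt_apply, mul_inv_rev, mul_smul, charStab_smul ((S.Hst y₀ θ).inv_mem l.2)]
  refine Fintype.sum_equiv (Equiv.mulRight ⟨k₀, hk₀⟩) _ _ fun k => ?_
  have h1 : ((Equiv.mulRight (⟨k₀, hk₀⟩ : MulAction.stabilizer H y₀)) k : H) = k * k₀ := rfl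
  rw [h1, hp2, mul_inv_rev, mul_smul k₀⁻¹]
  refine if_congr ?_ rfl rfl
  rw [hp1, ← mul_smul, mul_assoc]

/-- The spherical function of `F_{θ,j}` as an unfolded sum over `H_θ`, before the grouping into
double cosets of `K_θ`. -/
lemma sphFun_invVec (hσ : IsUnitaryRep σ) (g : Semi H A) :
    sphFun (WInner (S.infl y₀ θ) σ) (WRep (S.infl y₀ θ) σ) (S.invVec y₀ θ σ u) g =
      ((Nat.card (MulAction.stabilizer H y₀) : ℂ) * Nat.card (S.Kst y₀ θ))⁻¹ *
        ∑ l : S.Hst y₀ θ, sphFun sp σ u l *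
          S.orbitCharSum θ (g.right • y₀) g.left.toAdd l := by
  have h1 := S.WInner_WRep_invVec y₀ θ (u := u) hσ
    ((S.normFactor y₀ θ : ℂ)⁻¹ • orbitSum (MulAction.stabilizer H y₀) (S.Hst y₀ θ) σ u) g
  refine h1.trans ?_
  -- The index `h₀` of `orbitSum` is replaced by `l = h₀⁻¹`, and then `h` by `k = h l⁻¹`.
  have h2 : ∀ h : H, (if h • y₀ = g.right • y₀ then
      S.infl y₀ θ (h⁻¹ • g.left.toAdd) * sp (((S.normFactor y₀ θ : ℂ)⁻¹ •
        orbitSum (MulAction.stabilizer H y₀) (S.Hst y₀ θ) σ u).1 h) u else 0) =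
      (S.normFactor y₀ θ : ℂ)⁻¹ * ∑ l : S.Hst y₀ θ, if h * (l : H)⁻¹ ∈ MulAction.stabilizer H y₀
        then (if g.right • y₀ = (h * (l : H)⁻¹ * l) • y₀ then
          sphFun sp σ u l * S.infl y₀ θ ((h * (l : H)⁻¹)⁻¹ • g.left.toAdd) else 0) else 0 := by
    intro h
    simp only [inv_mul_cancel_right]
    by_cases hh : h • y₀ = g.right • y₀
    · rw [if_pos hh]
      simp only [if_pos hh.symm]
      change _ * sp ((S.normFactor y₀ θ : ℂ)⁻¹ •
        (orbitSum (MulAction.stabilizer H y₀) (S.Hst y₀ θ) σ u).1 h) u = _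
      rw [sp_smul_left, mul_left_comm, orbitSum_apply, sp_sum_left, Finset.mul_sum,
        Finset.sum_filter]
      congr 1
      refine Fintype.sum_equiv (Equiv.inv _) _ _ fun l => ?_
      have h3 : ((Equiv.inv (S.Hst y₀ θ)) l : H)⁻¹ = l := inv_inv _
      have h4 : sphFun sp σ u ((Equiv.inv (S.Hst y₀ θ)) l) = sp (σ l u) u := by
        change sp u (σ l⁻¹ u) = _
        rw [hσ.sp_apply_right, inv_inv]
      rw [h3, h4, mul_inv_rev, mul_smul, charStab_smul ((S.Hst y₀ θ).inv_mem l.2), mul_comm]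
      exact if_congr Iff.rfl rfl rfl
    · rw [if_neg hh]
      simp [Ne.symm hh]
  rw [Finset.sum_congr rfl fun h _ => h2 h, ← Finset.mul_sum, ← mul_assoc, ← mul_inv,
    normFactor_mul_self, Finset.sum_comm]
  congr 1
  refine Finset.sum_congr rfl fun l _ => ?_
  rw [orbitCharSum, sum_subgroup_eq_sum_ite _ fun k => if g.right • y₀ = (k * (l : H)) • y₀ then
    S.infl y₀ θ (k⁻¹ • g.left.toAdd) else 0, Finset.mul_sum]
  refine Fintype.sum_equiv (Equiv.mulRight (l : H)⁻¹) _ _ fun h => ?_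
  have h3 : (Equiv.mulRight (l : H)⁻¹) h = h * (l : H)⁻¹ := rfl
  rw [h3, mul_ite, mul_ite, mul_zero]
  exact if_congr Iff.rfl rfl rfl

/-- The expansion of the spherical function in the functions `Λ_{z,χ}`. -/
lemma sphFun_invVec_eq_sum_Lam [Fintype Y] [∀ y, Fintype (B y)] (hσ : IsUnitaryRep σ)
    (hinv : ∀ k ∈ S.Kst y₀ θ, σ k u = u) {Γ : Set S.Dual} (hΓ : S.IsTransversal (H := H) y₀ Γ)
    (l₀ : S.Dual → S.Hst y₀ θ)
    (hl₀ : ∀ p ∈ S.GammaTheta (H := H) y₀ Γ θ, ∃ k ∈ MulAction.stabilizer H y₀,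
      p = (k * (l₀ p : H)) • S.dpt y₀ θ) (g : Semi H A) :
    sphFun (WInner (S.infl y₀ θ) σ) (WRep (S.infl y₀ θ) σ) (S.invVec y₀ θ σ u) g =
      (((Nat.card (S.Kst y₀ θ) : ℂ) / Nat.card (MulAction.stabilizer H y₀)) •
        ∑ p : S.Dual with p ∈ S.GammaTheta (H := H) y₀ Γ θ,
          (((Nat.card (Kpt (H := H) y₀ p.1) : ℂ) / Nat.card (S.Kch (H := H) y₀ p)) *
            sphFun sp σ u (l₀ p)) • S.Lam y₀ p) (g • S.base y₀) := by
  have hKs : (Nat.card (S.Kst y₀ θ) : ℂ) ≠ 0 := Nat.cast_ne_zero.2 Nat.card_pos.ne'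
  rw [S.sphFun_invVec hσ, S.smul_base, sum_biinvariant hΓ
    (M := fun l => sphFun sp σ u l * S.orbitCharSum θ (g.right • y₀) g.left.toAdd l)
    (fun m hm l => by
      rw [S.sphFun_mul_left hσ hinv hm, S.orbitCharSum_mul_left _ _ hm])
    (fun m hm l => by
      rw [S.sphFun_mul_right hinv hm, S.orbitCharSum_mul_right _ _ hm]) l₀ hl₀]
  rw [Pi.smul_apply, Finset.sum_apply, smul_eq_mul, ← mul_assoc, mul_inv, mul_assoc _ _ (_ ^ 2),
    pow_two, inv_mul_cancel_left₀ hKs, inv_mul_eq_div]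
  congr 1
  refine Finset.sum_congr rfl fun p hp => ?_
  have hp' := (Finset.mem_filter.1 hp).2
  obtain ⟨k, hk, hpk⟩ := hl₀ p hp'
  have hz : (Nat.card (Kpt (H := H) y₀ p.1) : ℂ) ≠ 0 := Nat.cast_ne_zero.2 Nat.card_pos.ne'
  rw [Pi.smul_apply, smul_eq_mul, S.Lam_eq_orbitCharSum hk hpk (hΓ.1 hp'.1)]
  field_simp

end Spherical

/-! ### The intertwining operator -/

section Intertwining

variable {H A Y : Type*} [Group H] [Fintype H] [AddCommGroup A] [Fintype A]
  [DistribMulAction H A] [MulAction H Y] [MulAction.IsPretransitive H Y] {B : Y → Type*}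
  [∀ y, AddCommGroup (B y)] (S : FibreSystem H A Y B) {y₀ : Y}

/-- The intertwining operator associated with an invariant vector of an induced representation. -/
lemma exists_intertwiningMap {U : Type*} [NormedAddCommGroup U] [InnerProductSpace ℂ U]
    (L : Subgroup (Semi H A)) (τ : Representation ℂ L U) (F : indSpace L τ)
    (hF : ∀ g ∈ S.KC y₀, indRep L τ g F = F) :
    ∃ T : Representation.IntertwiningMap (indRep L τ) (permRep (Semi H A) S.Total),
      ∀ w, toGroup (G := Semi H A) (S.base y₀) (T w) =
        sphOp (S.KC y₀) (indInner L τ) (indRep L τ) F w := by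
  have h1 : ∀ w, ∃ Φ : S.Total → ℂ, toGroup (G := Semi H A) (S.base y₀) Φ =
      sphOp (S.KC y₀) (indInner L τ) (indRep L τ) F w := fun w =>
    S.exists_toGroup_eq y₀ _ fun g s hs => by
      simp only [sphOp]
      rw [map_mul, Module.End.mul_apply, hF s hs]
  choose T hT using h1
  have hT' : ∀ w g, T w (g • S.base y₀) =
    sphOp (S.KC y₀) (indInner L τ) (indRep L τ) F w g := fun w g => congrFun (hT w) g
  let T₀ : indSpace L τ →ₗ[ℂ] (S.Total → ℂ) :=
    { toFun := T
      map_add' := fun v w => by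
        funext x
        obtain ⟨g, rfl⟩ := S.exists_smul_base y₀ x
        have h2 : ∀ x, (v + w).1 x = v.1 x + w.1 x := fun _ => rfl
        rw [Pi.add_apply, hT', hT', hT']
        simp only [sphOp, indInner, h2, sp, inner_add_right, Finset.sum_add_distrib, mul_add]
      map_smul' := fun c w => by
        funext x
        obtain ⟨g, rfl⟩ := S.exists_smul_base y₀ x
        have h2 : ∀ x, (c • w).1 x = c • w.1 x := fun _ => rfl
        rw [Pi.smul_apply, hT', hT']
        simp only [sphOp, indInner, h2, sp, inner_smul_right, ← Finset.mul_sum, RingHom.id_apply,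
          smul_eq_mul]
        ring }
  refine ⟨LinearMap.intertwiningMap_of_isIntertwiningMap _ _ T₀ fun g w => ?_, hT⟩
  change T (indRep L τ g w) = permRep (Semi H A) S.Total g (T w)
  funext x
  obtain ⟨g', rfl⟩ := S.exists_smul_base y₀ x
  change _ = T w (g⁻¹ • g' • S.base y₀)
  rw [← mul_smul, hT', hT', sphOp, sphOp, indInner_indRep, ← Module.End.mul_apply, ← map_mul]

end Intertwining

/-! ### The expansion of the intertwining operator -/

section Constants

variable {H A Y : Type*} [Group H] [AddCommGroup A]
  [DistribMulAction H A] [MulAction H Y] {B : Y → Type*}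
  [∀ y, AddCommGroup (B y)] (S : FibreSystem H A Y B) (y₀ : Y) (θ : AddChar (B y₀) ℂ)

lemma card_eq_card_C_mul : Nat.card A = Nat.card (S.C y₀) * Nat.card (B y₀) := by
  rw [← AddSubgroup.card_mul_index (S.C y₀), C, AddSubgroup.index_ker,
    AddMonoidHom.range_eq_top.2 (S.proj_surjective y₀)]
  congr 1
  exact Nat.card_congr (Equiv.Set.univ _)

/-- The normalizing constants of `S_{θ,j}` and `T_{θ,j}` match, since
`dim W = |H| dim σ / |H_θ|` and `|A| = |C| |B|`. -/
lemma sqrt_const_eq [Fintype H] [Fintype A] {U : Type*} [AddCommGroup U] [Module ℂ U] [FiniteDimensional ℂ U]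
    (σ : Representation ℂ (S.Hst y₀ θ) U) :
    Real.sqrt ((Nat.card (S.KC y₀) : ℝ) *
        Module.finrank ℂ (WSpace (S.infl y₀ θ) σ) / Nat.card (Semi H A)) *
      ((S.normFactor y₀ θ)⁻¹ * Nat.card (S.Kst y₀ θ)) =
    (Real.sqrt (Nat.card (B y₀)))⁻¹ *
      Real.sqrt ((Nat.card (S.Kst y₀ θ) : ℝ) * Module.finrank ℂ U / Nat.card (S.Hst y₀ θ)) := by
  have hA := S.card_eq_card_C_mul y₀
  have hd := card_mul_finrank_indSpace _ (inertiaRep (S.infl y₀ θ) σ)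
  rw [card_inertia, card_semi] at hd
  have hKC : Nat.card (S.KC y₀) = Nat.card (MulAction.stabilizer H y₀) * Nat.card (S.C y₀) :=
    card_subSemi _ _ _
  have hApos : 0 < Nat.card A := Nat.card_pos
  have hBpos : 0 < Nat.card (B y₀) := Nat.pos_of_ne_zero fun h => by
    rw [h, mul_zero] at hA
    exact hApos.ne' hA
  have hCpos : 0 < Nat.card (S.C y₀) := Nat.card_pos
  have hHpos : 0 < Nat.card H := Nat.card_pos
  have hKpos : 0 < Nat.card (MulAction.stabilizer H y₀) := Nat.card_pos
  have hLpos : 0 < Nat.card (S.Hst y₀ θ) := Nat.card_pos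
  have hKspos : 0 < Nat.card (S.Kst y₀ θ) := Nat.card_pos
  rw [hKC, card_semi, normFactor, hA]
  rw [hA] at hd
  generalize Module.finrank ℂ (WSpace (S.infl y₀ θ) σ) = D at *
  generalize Nat.card (B y₀) = b at *
  generalize Nat.card (S.C y₀) = c at *
  generalize Nat.card H = n at *
  generalize Nat.card (MulAction.stabilizer H y₀) = k at *
  generalize Nat.card (S.Hst y₀ θ) = l at *
  generalize Nat.card (S.Kst y₀ θ) = m at *
  generalize Module.finrank ℂ U = d at *
  have hd' : (l : ℝ) * (c * b) * D = n * (c * b) * d := by exact_mod_cast hd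
  have hb : (0 : ℝ) < b := by exact_mod_cast hBpos
  have hc : (0 : ℝ) < c := by exact_mod_cast hCpos
  have hn : (0 : ℝ) < n := by exact_mod_cast hHpos
  have hk : (0 : ℝ) < k := by exact_mod_cast hKpos
  have hl : (0 : ℝ) < l := by exact_mod_cast hLpos
  have hm : (0 : ℝ) < m := by exact_mod_cast hKspos
  refine (sq_eq_sq₀ (by positivity) (by positivity)).1 ?_
  push_cast
  rw [mul_pow, mul_pow, mul_pow, inv_pow, inv_pow, Real.sq_sqrt (by positivity),
    Real.sq_sqrt (by positivity), Real.sq_sqrt (by positivity), Real.sq_sqrt (by positivity)]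
  have hD : (l : ℝ) * D = n * d := by
    have hcb : (c : ℝ) * b ≠ 0 := by positivity
    exact mul_right_cancel₀ hcb (by linear_combination hd')
  field_simp
  linear_combination hD

end Constants

section Lift

variable {H A Y : Type*} [Group H] [Fintype H] [AddCommGroup A] [Fintype A]
  [DistribMulAction H A] [MulAction H Y] [Fintype Y] {B : Y → Type*}
  [∀ y, AddCommGroup (B y)] [∀ y, Fintype (B y)] (S : FibreSystem H A Y B) {y₀ : Y}
  {θ : AddChar (B y₀) ℂ} {U : Type*} [NormedAddCommGroup U] [InnerProductSpace ℂ U]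
  [FiniteDimensional ℂ U] {σ : Representation ℂ (S.Hst y₀ θ) U} {u : U}

/-- The expansion of `S_{θ,j} F_f` in the functions `χ^♯`. -/
lemma sphOp_liftW_eq_sum_sharp (hσ : IsUnitaryRep σ) (hinv : ∀ k ∈ S.Kst y₀ θ, σ k u = u)
    (h t : S.Dual → H) (s k : S.Dual → S.Hst y₀ θ)
    (hyp : ∀ p ∈ S.dualTheta (H := H) y₀ θ, h p • S.dpt y₀ θ = p ∧ k p ∈ S.Kst y₀ θ ∧
      h p = t p * (s p : H) * (k p : H)) (f : indSpace (S.Hst y₀ θ) σ) (g : Semi H A) :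
    sphOp (S.KC y₀) (WInner (S.infl y₀ θ) σ) (WRep (S.infl y₀ θ) σ) (S.invVec y₀ θ σ u)
        (liftW (S.infl y₀ θ) σ f) g =
      ((Real.sqrt (Nat.card (B y₀)) : ℂ)⁻¹ •
        ∑ y : Y, ∑ χ : AddChar (B y) ℂ with S.dpt y χ ∈ S.dualTheta (H := H) y₀ θ,
          sphOp (S.Kst y₀ θ) sp σ u (f.1 (t (S.dpt y χ))) (s (S.dpt y χ)) •
            S.sharp (S.dpt y χ)) (g • S.base y₀) := by
  have hP : ∀ x, ∀ m ∈ S.Kst y₀ θ,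
      S.infl y₀ θ ((x * (m : H))⁻¹ • g.left.toAdd) * sp (f.1 (x * (m : H))) u =
        S.infl y₀ θ (x⁻¹ • g.left.toAdd) * sp (f.1 x) u := by
    intro x m hm
    rw [mul_inv_rev, mul_smul, charStab_smul ((S.Hst y₀ θ).inv_mem m.2), f.2,
      ← hσ.sp_apply_right, hinv m hm]
  have h1 : (∑ y : Y, ∑ χ : AddChar (B y) ℂ with S.dpt y χ ∈ S.dualTheta (H := H) y₀ θ,
      sphOp (S.Kst y₀ θ) sp σ u (f.1 (t (S.dpt y χ))) (s (S.dpt y χ)) • S.sharp (S.dpt y χ)) =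
      ∑ p : S.Dual with p ∈ S.dualTheta (H := H) y₀ θ,
        sphOp (S.Kst y₀ θ) sp σ u (f.1 (t p)) (s p) • S.sharp p := by
    simp only [Finset.sum_filter]
    exact (Fintype.sum_sigma (fun p : Σ y, AddChar (B y) ℂ =>
      if S.dpt p.1 p.2 ∈ S.dualTheta (H := H) y₀ θ then
        sphOp (S.Kst y₀ θ) sp σ u (f.1 (t (S.dpt p.1 p.2))) (s (S.dpt p.1 p.2)) •
          S.sharp (S.dpt p.1 p.2) else 0)).symm
  have h2 : ∀ p ∈ S.dualTheta (H := H) y₀ θ,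
      (sphOp (S.Kst y₀ θ) sp σ u (f.1 (t p)) (s p) • S.sharp p) (g • S.base y₀) =
        (Real.sqrt ((Nat.card (S.Kst y₀ θ) : ℝ) * Module.finrank ℂ U /
          Nat.card (S.Hst y₀ θ)) : ℂ) * if p.1 = g.right • y₀ then
            S.infl y₀ θ ((h p)⁻¹ • g.left.toAdd) * sp (f.1 (h p)) u else 0 := by
    intro p hp
    obtain ⟨hp1, hk, hts⟩ := hyp p hp
    have h3 : ∀ b, p.2 (S.proj p.1 b) = S.infl y₀ θ ((h p)⁻¹ • b) := by
      intro b
      conv_lhs => rw [← hp1]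
      rw [smul_dpt_apply]
    have h4 : sp (f.1 (t p)) (σ (s p) u) = sp (f.1 (h p)) u := by
      rw [hts, f.2, f.2, ← hσ.sp_apply_right, ← hσ.sp_apply_right, hinv _ hk]
    rw [Pi.smul_apply, S.smul_base, sharp_pt_proj, h3, sphOp, h4, smul_eq_mul, mul_assoc]
    congr 1
    by_cases h5 : p.1 = g.right • y₀
    · rw [if_pos h5.symm, if_pos h5, mul_comm]
    · rw [if_neg (Ne.symm h5), if_neg h5, mul_zero]
  have hconst := congrArg (Complex.ofReal) (S.sqrt_const_eq y₀ θ σ)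
  rw [Complex.ofReal_mul, Complex.ofReal_mul, Complex.ofReal_mul, Complex.ofReal_inv,
    Complex.ofReal_inv, Complex.ofReal_natCast] at hconst
  rw [h1, Pi.smul_apply, Finset.sum_apply,
    Finset.sum_congr rfl fun p hp => h2 p (Finset.mem_filter.1 hp).2, ← Finset.mul_sum, sphOp,
    S.WInner_WRep_invVec y₀ θ hσ, sum_eq_sum_dualTheta
      (P := fun x => S.infl y₀ θ (x⁻¹ • g.left.toAdd) * sp (f.1 x) u) hP _ h
      (fun p hp => (hyp p hp).1), smul_eq_mul, ← mul_assoc, ← mul_assoc,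
    ← mul_assoc, mul_assoc _ (S.normFactor y₀ θ : ℂ)⁻¹, hconst]

end Lift

end FibreSystem

end SphSemi

end

theorem mainTheorem4
    {H A Y : Type*} [Group H] [Fintype H] [AddCommGroup A] [Fintype A] [DistribMulAction H A]
    [Fintype Y] [MulAction H Y] [MulAction.IsPretransitive H Y]
    {B : Y → Type*} [∀ y, AddCommGroup (B y)] [∀ y, Fintype (B y)]
    (S : SphSemi.FibreSystem H A Y B) (y₀ : Y)
    (hG : SphSemi.IsGelfandPair (S.KC y₀))
    (Γ : Set S.Dual) (hΓ : S.IsTransversal y₀ Γ)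
    (θ : AddChar (B y₀) ℂ)
    {U : Type*} [NormedAddCommGroup U] [InnerProductSpace ℂ U] [FiniteDimensional ℂ U]
    (σ : Representation ℂ (S.Hst y₀ θ) U) (hσ : SphSemi.IsUnitaryRep σ)
    (hirr : σ.IsIrreducible) (hocc : SphSemi.OccursIn (S.Kst y₀ θ) σ) :
    (∃ u : U, ‖u‖ = 1 ∧ ∀ k ∈ S.Kst y₀ θ, σ k u = u) ∧
    ∀ u : U, ‖u‖ = 1 → (∀ k ∈ S.Kst y₀ θ, σ k u = u) →
      ∃ (F : SphSemi.WSpace (S.infl y₀ θ) σ),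
        -- the explicit unit invariant vector
        F.1 = S.sphVec y₀ θ σ u ∧
        SphSemi.WInner (S.infl y₀ θ) σ F F = 1 ∧
        (∀ g ∈ S.KC y₀, SphSemi.WRep (S.infl y₀ θ) σ g F = F) ∧
        -- the spherical function, as an element of `L(X)`
        (∃ Φ : S.Total → ℂ,
          SphSemi.toGroup (G := SphSemi.Semi H A) (S.base y₀) Φ =
            SphSemi.sphFun (SphSemi.WInner (S.infl y₀ θ) σ) (SphSemi.WRep (S.infl y₀ θ) σ) F ∧
          ∀ h₀ : S.Dual → S.Hst y₀ θ,
            (∀ p ∈ S.GammaTheta y₀ Γ θ, ∃ k ∈ MulAction.stabilizer H y₀,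
              p = (k * (h₀ p : H)) • S.dpt y₀ θ) →
            Φ = ((Nat.card (S.Kst y₀ θ) : ℂ) / Nat.card (MulAction.stabilizer H y₀)) •
              ∑ p : S.Dual with p ∈ S.GammaTheta y₀ Γ θ,
                (((Nat.card (SphSemi.FibreSystem.Kpt (H := H) y₀ p.1) : ℂ) /
                    Nat.card (S.Kch y₀ p)) *
                  SphSemi.sphFun SphSemi.sp σ u (h₀ p)) • S.Lam y₀ p) ∧
        -- the intertwining operator `W → L(X)`
        (∃ T : Representation.IntertwiningMap (SphSemi.WRep (S.infl y₀ θ) σ)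
            (SphSemi.permRep (SphSemi.Semi H A) S.Total),
          (∀ w, SphSemi.toGroup (G := SphSemi.Semi H A) (S.base y₀) (T w) =
            SphSemi.sphOp (S.KC y₀) (SphSemi.WInner (S.infl y₀ θ) σ)
              (SphSemi.WRep (S.infl y₀ θ) σ) F w) ∧
          ∀ (𝒯 : Set H) (𝒮 : Set (S.Hst y₀ θ)),
            Subgroup.IsComplement 𝒯 (S.Hst y₀ θ : Set H) →
            Subgroup.IsComplement 𝒮 (S.Kst y₀ θ : Set (S.Hst y₀ θ)) →
            ∀ (h t : S.Dual → H) (s k : S.Dual → S.Hst y₀ θ),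
              (∀ p ∈ S.dualTheta y₀ θ, h p • S.dpt y₀ θ = p ∧ t p ∈ 𝒯 ∧ s p ∈ 𝒮 ∧
                k p ∈ S.Kst y₀ θ ∧ h p = t p * (s p : H) * (k p : H)) →
              ∀ f : SphSemi.indSpace (S.Hst y₀ θ) σ,
                T (SphSemi.liftW (S.infl y₀ θ) σ f) =
                  ((Real.sqrt (Nat.card (B y₀)) : ℂ))⁻¹ •
                    ∑ y : Y, ∑ χ : AddChar (B y) ℂ with S.dpt y χ ∈ S.dualTheta y₀ θ,
                      SphSemi.sphOp (S.Kst y₀ θ) SphSemi.sp σ u (f.1 (t (S.dpt y χ)))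
                        (s (S.dpt y χ)) • S.sharp (S.dpt y χ)) := by
  refine ⟨hocc.exists_invariant hσ, fun u hu hinv => ⟨S.invVec y₀ θ σ u, S.invVec_coe y₀ θ hσ,
    S.WInner_invVec_self y₀ θ hσ hu hinv, fun g hg => S.WRep_invVec_of_mem y₀ θ hg, ?_, ?_⟩⟩
  · obtain ⟨Φ, hΦ⟩ := S.exists_toGroup_eq y₀
      (SphSemi.sphFun (SphSemi.WInner (S.infl y₀ θ) σ) (SphSemi.WRep (S.infl y₀ θ) σ)
        (S.invVec y₀ θ σ u)) fun g s hs => by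
          simp only [SphSemi.sphFun]
          rw [map_mul, Module.End.mul_apply, S.WRep_invVec_of_mem y₀ θ hs]
    refine ⟨Φ, hΦ, fun h₀ hh₀ => S.toGroup_injective (H := H) y₀ ?_⟩
    rw [hΦ]
    exact funext fun g => S.sphFun_invVec_eq_sum_Lam hσ hinv hΓ h₀ hh₀ g
  · obtain ⟨T, hT⟩ := S.exists_intertwiningMap _ (SphSemi.inertiaRep (S.infl y₀ θ) σ)
      (S.invVec y₀ θ σ u) fun g hg => S.WRep_invVec_of_mem y₀ θ hg
    refine ⟨T, hT, fun 𝒯 𝒮 _ _ h t s k hyp f => S.toGroup_injective (H := H) y₀ ?_⟩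
    rw [hT]
    exact funext fun g => S.sphOp_liftW_eq_sum_sharp hσ hinv h t s k
      (fun p hp => ⟨(hyp p hp).1, (hyp p hp).2.2.2.1, (hyp p hp).2.2.2.2⟩) f g
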